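/- Let $I$ and $K$ be arbitrary index sets (for example $I=K=\{1,2,\dots\}$, or $I=\{1,\dots,m\}$, $K=\{1,\dots,n\}$), and write $[x,y]=xy-yx$, $\{x,y\}=xy+yx$. Let $P_{BF}$ be the relative parabose set: the associative unital complex algebra generated by $B_i^{\pm}$ $(i\in I)$ and $F_j^{\pm}$ $(j\in K)$ subject to the relations, for all admissible indices and all signs $\xi,\eta,\epsilon=\pm$ (read as $\pm1$ in scalars), $$[\{B_i^{\xi},B_j^{\eta}\},B_k^{\epsilon}]=(\epsilon-\eta)\delta_{jk}B_i^{\xi}+(\epsilon-\xi)\delta_{ik}B_j^{\eta},$$ $$[[F_i^{\xi},F_j^{\eta}],F_k^{\epsilon}]=\tfrac12(\epsilon-\eta)^2\delta_{jk}F_i^{\xi}-\tfrac12(\epsilon-\xi)^2\delta_{ik}F_j^{\eta},$$ $$[\{B_k^{\xi},B_l^{\eta}\},F_m^{\epsilon}]=0,\qquad [[F_k^{\xi},F_l^{\eta}],B_m^{\epsilon}]=0,$$ $$[\{F_m^{\xi},B_k^{\eta}\},B_l^{\epsilon}]=(\epsilon-\eta)\delta_{kl}F_m^{\xi},\qquad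 \{\{B_m^{\xi},F_k^{\eta}\},F_l^{\epsilon}\}=\tfrac12(\epsilon-\eta)^2\delta_{kl}B_m^{\xi}.$$ Let $\theta(a,b)=(-1)^{a_1b_1+a_2b_2}$ on $\mathbb Z_2\times\mathbb Z_2$. A $(G,\theta)$-Lie algebra, for an abelian group $G$ and a commutation factor $\theta:G\times G\to\mathbb C^*$ (a bicharacter with $\theta(a,b)\theta(b,a)=1$), is a complex $G$-graded vector space $L=\bigoplus_{a\in G}L_a$ with a bilinear bracket such that, for $x\in L_a$, $y\in L_b$, $z\in L_c$, one has $\langle x,y\rangle\in L_{a+b}$, $\langle x,y\rangle=-\theta(a,b)\langle y,x\rangle$ and $\theta(c,a)\langle x,\langle y,z\rangle\rangle+\theta(b,c)\langle z,\langle x,y\rangle\rangle+\theta(a,b)\langle y,\langle z,x\rangle\rangle=0$. Its universal enveloping algebra (UEA) $\mathbb U(L)$ is the tensor algebra of $L$ modulo the relations $xy-\theta(a,b)yx=\langle x,y\rangle$ for $x\in L_a$, $y\in L_b$. A Lie superalgebra is the case $G=\mathbb Z_2$, $\theta(a,b)=(-1)^{ab}$. In $P_{BF}$, let $L_{00}$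 be the linear span of all $\{B_k^{\epsilon},B_l^{\eta}\}$ and $[F_\alpha^{\epsilon},F_\beta^{\eta}]$, $L_{01}$ the span of all $\{F_\alpha^{\epsilon},B_k^{\eta}\}$, $L_{10}$ the span of all $B_k^{\epsilon}$, and $L_{11}$ the span of all $F_\alpha^{\epsilon}$. Then the sum $L=L_{00}+L_{01}+L_{10}+L_{11}$ is direct; with the color bracket determined by $\langle x,y\rangle=xy-\theta(a,b)yx$ for $x\in L_a$, $y\in L_b$, it is a $(\mathbb Z_2\times\mathbb Z_2,\theta)$-Lie algebra, and the inclusion $L\subset P_{BF}$ induces an isomorphism $\mathbb U(L)\cong P_{BF}$. Moreover, the linear span of all the elements $\{B_k^{\epsilon},B_l^{\eta}\}$, $[F_\alpha^{\epsilon},F_\beta^{\eta}]$, $\{F_\alpha^{\epsilon},B_k^{\eta}\}$ is a Lie superalgebra $L_{00}\oplus L_{01}$, with even part $L_{00}$ and odd part $L_{01}$, under the restriction of this color bracket. The UEA of this Lie superalgebra is a subalgebra of $P_{BF}$: the inclusion $L_{00}\oplus L_{01}\subset P_{BF}$ extends to an injective algebra homomorphism $\mathbb U(L_{00}\oplus L_{01})\to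 P_{BF}$, whose image is the subalgebra of $P_{BF}$ generated by $L_{00}\oplus L_{01}$. -/

import Mathlib

noncomputable section

/-- A commutation factor (color function) on an abelian group `G`, with values in `ℂ*`. -/
structure CommutationFactor (G : Type*) [AddCommGroup G] where
  val : G → G → ℂˣ
  add_left : ∀ a b c, val (a + b) c = val a c * val b c
  add_right : ∀ a b c, val a (b + c) = val a b * val a c
  skew : ∀ a b, val a b * val b a = 1

/-- A `θ`-colored `G`-graded Lie algebra structure on the complex vector space `L`. -/
structure ColorLieAlgebra {G : Type*} [AddCommGroup G] [DecidableEq G]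
    (θ : CommutationFactor G) (L : Type*) [AddCommGroup L] [Module ℂ L] where
  /-- the homogeneous components -/
  piece : G → Submodule ℂ L
  /-- `L` is the (internal) direct sum of its homogeneous components -/
  isInternal : DirectSum.IsInternal piece
  bracket : L →ₗ[ℂ] L →ₗ[ℂ] L
  bracket_mem : ∀ {a b : G} {x y : L}, x ∈ piece a → y ∈ piece b →
    bracket x y ∈ piece (a + b)
  antisymm : ∀ {a b : G} {x y : L}, x ∈ piece a → y ∈ piece b →
    bracket x y = -((θ.val a b : ℂ) • bracket y x)
  jacobi : ∀ {a b c : G} {x y z : L}, x ∈ piece a → y ∈ piece b → z ∈ piece c →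
    (θ.val c a : ℂ) • bracket x (bracket y z) + (θ.val b c : ℂ) • bracket z (bracket x y)
      + (θ.val a b : ℂ) • bracket y (bracket z x) = 0

namespace ColorLieAlgebra

variable {G : Type*} [AddCommGroup G] [DecidableEq G] {θ : CommutationFactor G}
  {L : Type*} [AddCommGroup L] [Module ℂ L]

/-- The relations `x y - θ(a, b) y x = ⟨x, y⟩` (`x`, `y` homogeneous of degrees `a`, `b`) imposed
on the tensor algebra of `L`. -/
inductive UEARel (A : ColorLieAlgebra θ L) : TensorAlgebra ℂ L → TensorAlgebra ℂ L → Prop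
  | comm {a b : G} {x y : L} (hx : x ∈ A.piece a) (hy : y ∈ A.piece b) :
      UEARel A
        (TensorAlgebra.ι ℂ x * TensorAlgebra.ι ℂ y
          - (θ.val a b : ℂ) • (TensorAlgebra.ι ℂ y * TensorAlgebra.ι ℂ x))
        (TensorAlgebra.ι ℂ (A.bracket x y))

/-- The universal enveloping algebra of a color Lie algebra. -/
abbrev UEA (A : ColorLieAlgebra θ L) : Type _ := RingQuot (UEARel A)

/-- The canonical linear map from a color Lie algebra to its universal enveloping algebra. -/
def toUEA (A : ColorLieAlgebra θ L) : L →ₗ[ℂ] A.UEA :=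
  (RingQuot.mkAlgHom ℂ (UEARel A)).toLinearMap ∘ₗ TensorAlgebra.ι ℂ

end ColorLieAlgebra

/-- The commutation factor `(-1) ^ (a b)` on `ℤ₂`. -/
def superFactor : CommutationFactor (ZMod 2) where
  val a b := (-1) ^ (a * b).val
  add_left := by
    have h : ∀ a b c : ZMod 2,
        ((-1 : ℤˣ)) ^ ((a + b) * c).val = (-1) ^ (a * c).val * (-1) ^ (b * c).val := by decide
    intro a b c
    simpa using congrArg (Units.map (Int.castRingHom ℂ).toMonoidHom) (h a b c)
  add_right := by
    have h : ∀ a b c : ZMod 2,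
        ((-1 : ℤˣ)) ^ (a * (b + c)).val = (-1) ^ (a * b).val * (-1) ^ (a * c).val := by decide
    intro a b c
    simpa using congrArg (Units.map (Int.castRingHom ℂ).toMonoidHom) (h a b c)
  skew := by
    have h : ∀ a b : ZMod 2, ((-1 : ℤˣ)) ^ (a * b).val * (-1) ^ (b * a).val = 1 := by decide
    intro a b
    simpa using congrArg (Units.map (Int.castRingHom ℂ).toMonoidHom) (h a b)

/-- The commutation factor `(-1) ^ (a₁ b₁ + a₂ b₂)` on `ℤ₂ × ℤ₂`. -/
def paraFactor : CommutationFactor (ZMod 2 × ZMod 2) where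
  val a b := (-1) ^ (a.1 * b.1 + a.2 * b.2).val
  add_left := by
    have h : ∀ a b c : ZMod 2 × ZMod 2,
        ((-1 : ℤˣ)) ^ ((a + b).1 * c.1 + (a + b).2 * c.2).val
          = (-1) ^ (a.1 * c.1 + a.2 * c.2).val * (-1) ^ (b.1 * c.1 + b.2 * c.2).val := by decide
    intro a b c
    simpa using congrArg (Units.map (Int.castRingHom ℂ).toMonoidHom) (h a b c)
  add_right := by
    have h : ∀ a b c : ZMod 2 × ZMod 2,
        ((-1 : ℤˣ)) ^ (a.1 * (b + c).1 + a.2 * (b + c).2).val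
          = (-1) ^ (a.1 * b.1 + a.2 * b.2).val * (-1) ^ (a.1 * c.1 + a.2 * c.2).val := by decide
    intro a b c
    simpa using congrArg (Units.map (Int.castRingHom ℂ).toMonoidHom) (h a b c)
  skew := by
    have h : ∀ a b : ZMod 2 × ZMod 2,
        ((-1 : ℤˣ)) ^ (a.1 * b.1 + a.2 * b.2).val * (-1) ^ (b.1 * a.1 + b.2 * a.2).val = 1 := by
      decide
    intro a b
    simpa using congrArg (Units.map (Int.castRingHom ℂ).toMonoidHom) (h a b)

/-- A complex Lie superalgebra structure on `L`. -/
abbrev LieSuperalgebra (L : Type*) [AddCommGroup L] [Module ℂ L] : Type _ :=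
  ColorLieAlgebra superFactor L

/-- The commutator `[x, y] = x y - y x`. -/
def commut {A : Type*} [Ring A] (x y : A) : A := x * y - y * x

/-- The anticommutator `{x, y} = x y + y x`. -/
def anticommut {A : Type*} [Ring A] (x y : A) : A := x * y + y * x

namespace RelParabose

/-- Generators: `B i ε` is the parabosonic generator `B_i^ε` and `F j ε` is the parafermionic
generator `F_j^ε`, where the sign `ε = ±` is an element of `ℤˣ = {1, -1}`. -/
inductive Gen (ι κ : Type*)
  | B (i : ι) (ε : ℤˣ) : Gen ι κ
  | F (j : κ) (ε : ℤˣ) : Gen ι κ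

variable (ι κ : Type*) [DecidableEq ι] [DecidableEq κ]

/-- Kronecker delta. -/
def kron {α : Type*} [DecidableEq α] (i j : α) : ℂ := if i = j then 1 else 0

/-- The sign `ε = ±` as a complex number. -/
def sgn (ε : ℤˣ) : ℂ := ((ε : ℤ) : ℂ)

/-- A parabosonic generator in the free algebra. -/
def freeB (i : ι) (ε : ℤˣ) : FreeAlgebra ℂ (Gen ι κ) := FreeAlgebra.ι ℂ (Gen.B i ε)

/-- A parafermionic generator in the free algebra. -/
def freeF (j : κ) (ε : ℤˣ) : FreeAlgebra ℂ (Gen ι κ) := FreeAlgebra.ι ℂ (Gen.F j ε)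

/-- The defining trilinear relations of the relative parabose set. -/
inductive Rel : FreeAlgebra ℂ (Gen ι κ) → FreeAlgebra ℂ (Gen ι κ) → Prop
  | BBB (i j k : ι) (ξ η ε : ℤˣ) :
      Rel (commut (anticommut (freeB ι κ i ξ) (freeB ι κ j η)) (freeB ι κ k ε))
        (((sgn ε - sgn η) * kron j k) • freeB ι κ i ξ
          + ((sgn ε - sgn ξ) * kron i k) • freeB ι κ j η)
  | FFF (i j k : κ) (ξ η ε : ℤˣ) :
      Rel (commut (commut (freeF ι κ i ξ) (freeF ι κ j η)) (freeF ι κ k ε))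
        ((1 / 2 * (sgn ε - sgn η) ^ 2 * kron j k) • freeF ι κ i ξ
          - (1 / 2 * (sgn ε - sgn ξ) ^ 2 * kron i k) • freeF ι κ j η)
  | BBF (k l : ι) (m : κ) (ξ η ε : ℤˣ) :
      Rel (commut (anticommut (freeB ι κ k ξ) (freeB ι κ l η)) (freeF ι κ m ε)) 0
  | FFB (k l : κ) (m : ι) (ξ η ε : ℤˣ) :
      Rel (commut (commut (freeF ι κ k ξ) (freeF ι κ l η)) (freeB ι κ m ε)) 0
  | FBB (m : κ) (k l : ι) (ξ η ε : ℤˣ) :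
      Rel (commut (anticommut (freeF ι κ m ξ) (freeB ι κ k η)) (freeB ι κ l ε))
        (((sgn ε - sgn η) * kron k l) • freeF ι κ m ξ)
  | BFF (m : ι) (k l : κ) (ξ η ε : ℤˣ) :
      Rel (anticommut (anticommut (freeB ι κ m ξ) (freeF ι κ k η)) (freeF ι κ l ε))
        ((1 / 2 * (sgn ε - sgn η) ^ 2 * kron k l) • freeB ι κ m ξ)

/-- The relative parabose set `P_BF`, with parabosonic generators indexed by `ι` and
parafermionic generators indexed by `κ`, as an associative unital complex algebra. -/
abbrev PBF : Type _ := RingQuot (Rel ι κ)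

variable {ι} in
/-- The parabosonic generator `B_i^ε` of `P_BF`. -/
def B (i : ι) (ε : ℤˣ) : PBF ι κ := RingQuot.mkAlgHom ℂ (Rel ι κ) (freeB ι κ i ε)

variable {κ} in
/-- The parafermionic generator `F_j^ε` of `P_BF`. -/
def F (j : κ) (ε : ℤˣ) : PBF ι κ := RingQuot.mkAlgHom ℂ (Rel ι κ) (freeF ι κ j ε)

/-- The elements `{B_k^ε, B_l^η}` and `[F_α^ε, F_β^η]` of `P_BF`. -/
def gens00 : Set (PBF ι κ) :=
  {x | ∃ (k l : ι) (ε η : ℤˣ), x = anticommut (B κ k ε) (B κ l η)} ∪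
    {x | ∃ (α β : κ) (ε η : ℤˣ), x = commut (F ι α ε) (F ι β η)}

/-- The elements `{F_α^ε, B_k^η}` of `P_BF`. -/
def gens01 : Set (PBF ι κ) :=
  {x | ∃ (α : κ) (k : ι) (ε η : ℤˣ), x = anticommut (F ι α ε) (B κ k η)}

/-- The generators `B_k^ε` of `P_BF`. -/
def gens10 : Set (PBF ι κ) := {x | ∃ (k : ι) (ε : ℤˣ), x = B κ k ε}

/-- The generators `F_α^ε` of `P_BF`. -/
def gens11 : Set (PBF ι κ) := {x | ∃ (α : κ) (ε : ℤˣ), x = F ι α ε}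

/-- The elements spanning the component of degree `a ∈ ℤ₂ × ℤ₂`. -/
def gensOf (a : ZMod 2 × ZMod 2) : Set (PBF ι κ) :=
  if a = (0, 0) then gens00 ι κ
  else if a = (0, 1) then gens01 ι κ
  else if a = (1, 0) then gens10 ι κ
  else gens11 ι κ

/-- The subspaces `L₀₀`, `L₀₁`, `L₁₀`, `L₁₁` of `P_BF`. -/
def gradedComp (a : ZMod 2 × ZMod 2) : Submodule ℂ (PBF ι κ) := Submodule.span ℂ (gensOf ι κ a)

/-- The subspace `L₀₀ + L₀₁ + L₁₀ + L₁₁` of `P_BF`. -/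
def colorSpace : Submodule ℂ (PBF ι κ) := ⨆ a, gradedComp ι κ a

/-- The subspace of `P_BF` spanned by all `{B_k^ε, B_l^η}`, `[F_α^ε, F_β^η]`, `{F_α^ε, B_k^η}`. -/
def superSpace : Submodule ℂ (PBF ι κ) := Submodule.span ℂ (gens00 ι κ ∪ gens01 ι κ)

theorem superSpace_le : superSpace ι κ ≤ colorSpace ι κ := by
  refine Submodule.span_le.2 (Set.union_subset ?_ ?_)
  · refine Set.Subset.trans ?_ (le_iSup (gradedComp ι κ) (0, 0))
    have h : gensOf ι κ (0, 0) = gens00 ι κ := by simp [gensOf]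
    exact h ▸ Submodule.subset_span
  · refine Set.Subset.trans ?_ (le_iSup (gradedComp ι κ) (0, 1))
    have h : gensOf ι κ (0, 1) = gens01 ι κ := by simp [gensOf]
    exact h ▸ Submodule.subset_span

/-- The inclusion of the span of the quadratic elements in the whole color Lie algebra. -/
def incl : superSpace ι κ →ₗ[ℂ] colorSpace ι κ := Submodule.inclusion (superSpace_le ι κ)

end RelParabose

end

open RelParabose

/-!
The relations of `P_BF` give the generators `B` and `F` the degrees `(1, 0)` and `(1, 1)`, and they
are homogeneous, so that `P_BF` has sign automorphisms. The subspaces `L₀₀`, `L₀₁`, `L₁₀`, `L₁₁` lie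
in distinct eigenspaces of a combination of two of them (`iSupIndep_gradedComp`), hence their sum is
direct. The color Jacobi identity holds in every associative algebra (`colorBracket_jacobi`), and
closure of the sum under the color bracket is what the trilinear relations say, together with the
fact that the bracket with an even element is a color derivation (`colorBracket_mem`). The
universal enveloping algebra of the color Lie algebra `L` satisfies the relations of `P_BF`, which
yields the inverse `toEnvHom` of the homomorphism `𝕌(L) → P_BF` extending the inclusion.

The one point that does not follow from universal properties is the injectivity of
`𝕌(L₀₀ ⊕ L₀₁) → P_BF`. It usually rests on the Poincaré-Birkhoff-Witt theorem, but in
characteristic zero the coproduct suffices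
(`ColorLieAlgebra.injective_of_injective_toEnv`). Let `f` be a homomorphism of universal enveloping
algebras that is induced by a morphism of color Lie algebras and is injective on the first Lie
algebra, and let `u` be an element of its kernel, of filtration degree `n + 1 ≥ 2`. By induction `f`
is injective in degree at most `n`, hence so is `f ⊗ f` on the tensor square of that subspace. Up to
terms in that tensor square the coproduct of `u` is `u ⊗ 1 + 1 ⊗ u` (`coprod_sub_mem_range`), and
`f ⊗ f` kills the difference; therefore `u` is primitive, and multiplication after the coproduct
maps `u` to `2 u`. On the other hand this map is `2 ^ (n + 1)` in degree `n + 1` up to terms of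
lower degree (`mul_coprod_sub_mem_filt`). So `u` has degree at most `n`, and is zero.
-/

open scoped TensorProduct

/-! ### Linear maps given on homogeneous components -/

section Glue

variable {G : Type*} [DecidableEq G] {L : Type*} [AddCommGroup L] [Module ℂ L]
  {𝒜 : G → Submodule ℂ L} (h𝒜 : DirectSum.IsInternal 𝒜)
  {N : Type*} [AddCommMonoid N] [Module ℂ N]

/-- The linear map that agrees with `g a` on the homogeneous component of degree `a`. -/
noncomputable def DirectSum.IsInternal.glue (g : G → L →ₗ[ℂ] N) : L →ₗ[ℂ] N :=
  DirectSum.toModule ℂ G N (fun a => g a ∘ₗ (𝒜 a).subtype) ∘ₗ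
    (LinearEquiv.ofBijective (DirectSum.coeLinearMap 𝒜) h𝒜).symm.toLinearMap

theorem DirectSum.IsInternal.glue_apply (g : G → L →ₗ[ℂ] N) {a : G} {x : L} (hx : x ∈ 𝒜 a) :
    h𝒜.glue g x = g a x := by
  have h : (LinearEquiv.ofBijective (DirectSum.coeLinearMap 𝒜) h𝒜).symm x
      = DirectSum.lof ℂ G (fun a => 𝒜 a) a ⟨x, hx⟩ := by
    rw [LinearEquiv.symm_apply_eq]
    exact (DirectSum.coeLinearMap_lof 𝒜 a ⟨x, hx⟩).symm
  simp only [DirectSum.IsInternal.glue, LinearMap.comp_apply, LinearEquiv.coe_coe]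
  rw [h, DirectSum.toModule_lof]
  rfl

end Glue

namespace ColorLieAlgebra

variable {G : Type*} [AddCommGroup G] [DecidableEq G] {θ : CommutationFactor G}
  {L : Type*} [AddCommGroup L] [Module ℂ L] (A : ColorLieAlgebra θ L)

theorem iSup_piece : ⨆ a, A.piece a = ⊤ := A.isInternal.submodule_iSup_eq_top

/-- A subspace that contains all homogeneous elements is everything. -/
theorem le_of_piece_le {N : Submodule ℂ L} (h : ∀ a, A.piece a ≤ N) (x : L) : x ∈ N := by
  have : (⊤ : Submodule ℂ L) ≤ N := A.iSup_piece ▸ iSup_le h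
  exact this trivial

/-! ### The universal property of the universal enveloping algebra -/

/-- The universal enveloping algebra as a type of its own, all of whose algebraic structure is
derived from a single ring structure. On `RingQuot` the semiring structure used by `UEA` and the
ring structure agree only after unfolding, which hides the additive group of the tensor square from
unification. -/
def Env : Type _ := A.UEA

noncomputable instance : Ring A.Env := inferInstanceAs (Ring A.UEA)

noncomputable instance : Algebra ℂ A.Env := inferInstanceAs (Algebra ℂ A.UEA)

/-- The identification of the two forms of the universal enveloping algebra. -/
noncomputable def envEquiv : A.UEA ≃ₐ[ℂ] A.Env := AlgEquiv.refl (A₁ := A.UEA)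

/-- The canonical map of a color Lie algebra to its universal enveloping algebra. -/
noncomputable def toEnv : L →ₗ[ℂ] A.Env := A.envEquiv.toLinearMap ∘ₗ A.toUEA

theorem toEnv_mul {a b : G} {x y : L} (hx : x ∈ A.piece a) (hy : y ∈ A.piece b) :
    A.toEnv x * A.toEnv y
      = A.toEnv (A.bracket x y) + (θ.val a b : ℂ) • (A.toEnv y * A.toEnv x) := by
  have := RingQuot.mkAlgHom_rel ℂ (UEARel.comm (A := A) hx hy)
  simp only [map_sub, map_smul, map_mul, sub_eq_iff_eq_add] at this
  simpa [toEnv, toUEA] using congrArg A.envEquiv this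

theorem toEnv_bracket {a b : G} {x y : L} (hx : x ∈ A.piece a) (hy : y ∈ A.piece b) :
    A.toEnv x * A.toEnv y - (θ.val a b : ℂ) • (A.toEnv y * A.toEnv x)
      = A.toEnv (A.bracket x y) :=
  sub_eq_of_eq_add (A.toEnv_mul hx hy)

section Lift

variable {R : Type*} [Semiring R] [Algebra ℂ R]

/-- The algebra homomorphism out of the universal enveloping algebra that extends a linear map
compatible with the color bracket. -/
noncomputable def lift (φ : L →ₗ[ℂ] R)
    (h : ∀ (a b : G) (x y : L), x ∈ A.piece a → y ∈ A.piece b →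
      φ x * φ y = φ (A.bracket x y) + (θ.val a b : ℂ) • (φ y * φ x)) : A.Env →ₐ[ℂ] R :=
  (RingQuot.liftAlgHom ℂ ⟨TensorAlgebra.lift ℂ φ, by
    let _ := Algebra.semiringToRing (A := R) ℂ
    rintro _ _ ⟨hx, hy⟩
    simpa [sub_eq_iff_eq_add] using h _ _ _ _ hx hy⟩ : A.UEA →ₐ[ℂ] R).comp A.envEquiv.symm.toAlgHom

@[simp]
theorem lift_toEnv (φ : L →ₗ[ℂ] R) (h) (x : L) : A.lift φ h (A.toEnv x) = φ x := by
  simp [lift, toEnv, toUEA]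

theorem hom_ext {f g : A.Env →ₐ[ℂ] R}
    (h : ∀ (a : G) (x : L), x ∈ A.piece a → f (A.toEnv x) = g (A.toEnv x)) : f = g := by
  have h' : ∀ x, f (A.toEnv x) = g (A.toEnv x) := fun x =>
    A.le_of_piece_le (N := LinearMap.eqLocus (f.toLinearMap ∘ₗ A.toEnv)
      (g.toLinearMap ∘ₗ A.toEnv)) (fun a x hx => h a x hx) x
  have h'' : f.comp A.envEquiv.toAlgHom = g.comp A.envEquiv.toAlgHom := by
    apply RingQuot.ringQuot_ext'
    apply TensorAlgebra.hom_ext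
    ext x
    exact h' x
  ext u
  exact DFunLike.congr_fun h'' (A.envEquiv.symm u)

end Lift

theorem adjoin_range_toEnv : Algebra.adjoin ℂ (Set.range A.toEnv) = ⊤ := by
  set T := Algebra.adjoin ℂ (Set.range A.toEnv)
  have hT : ∀ x, A.toEnv x ∈ T := fun x => Algebra.subset_adjoin ⟨x, rfl⟩
  let ψ : L →ₗ[ℂ] T := A.toEnv.codRestrict (Subalgebra.toSubmodule T) hT
  let φ : A.Env →ₐ[ℂ] T := A.lift ψ fun a b x y hx hy => Subtype.ext (A.toEnv_mul hx hy)
  have : T.val.comp φ = AlgHom.id ℂ _ := by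
    apply A.hom_ext
    intro a x _
    rw [AlgHom.comp_apply, A.lift_toEnv]
    rfl
  rw [eq_top_iff]
  intro u _
  have h := DFunLike.congr_fun this u
  simp only [AlgHom.comp_apply, AlgHom.id_apply] at h
  exact h ▸ (φ u).2

/-! ### Grading automorphisms, counit and coproduct -/

/-- The algebra endomorphism of the universal enveloping algebra that multiplies elements of
degree `b` by `θ(a, b)`. -/
noncomputable def twist (a : G) : A.Env →ₐ[ℂ] A.Env :=
  A.lift (A.isInternal.glue fun b => (θ.val a b : ℂ) • A.toEnv) (by
    intro b c x y hx hy
    rw [A.isInternal.glue_apply _ hx, A.isInternal.glue_apply _ hy,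
      A.isInternal.glue_apply _ (A.bracket_mem hx hy)]
    simp only [LinearMap.smul_apply, smul_mul_smul_comm, A.toEnv_mul hx hy, smul_add, smul_smul,
      θ.add_right, Units.val_mul]
    congr 2
    ring)

theorem twist_toEnv (a : G) {b : G} {x : L} (hx : x ∈ A.piece b) :
    A.twist a (A.toEnv x) = (θ.val a b : ℂ) • A.toEnv x := by
  simp [twist, A.isInternal.glue_apply _ hx]

theorem twist_add (a b : G) (u : A.Env) : A.twist a (A.twist b u) = A.twist (a + b) u := by
  have : (A.twist a).comp (A.twist b) = A.twist (a + b) := by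
    apply A.hom_ext
    intro c x hx
    simp [A.twist_toEnv _ hx, θ.add_left, smul_smul, mul_comm]
  exact DFunLike.congr_fun this u

/-- The counit, which kills the Lie algebra. -/
noncomputable def counit : A.Env →ₐ[ℂ] ℂ := A.lift 0 (by simp)

@[simp]
theorem counit_toEnv (x : L) : A.counit (A.toEnv x) = 0 := by simp [counit]

/-- The operator `x ⊗ 1 + 1 ⊗ x` of the color tensor square of the universal enveloping algebra,
for `x` of degree `a`, acting on the underlying tensor product: moving `x` past the first tensor
factor costs the sign operator `twist a`. -/
noncomputable def primOp (a : G) : L →ₗ[ℂ] Module.End ℂ (A.Env ⊗[ℂ] A.Env) :=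
  (TensorProduct.mapBilinear (.id ℂ) A.Env A.Env A.Env A.Env).flip LinearMap.id
      ∘ₗ LinearMap.mul ℂ A.Env ∘ₗ A.toEnv
    + TensorProduct.mapBilinear (.id ℂ) A.Env A.Env A.Env A.Env (A.twist a).toLinearMap
      ∘ₗ LinearMap.mul ℂ A.Env ∘ₗ A.toEnv

theorem primOp_tmul (a : G) (x : L) (p q : A.Env) :
    A.primOp a x (p ⊗ₜ q) = (A.toEnv x * p) ⊗ₜ q + A.twist a p ⊗ₜ (A.toEnv x * q) := by
  simp [primOp]

/-- The operators `primOp` satisfy the defining relations of the universal enveloping algebra: the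
mixed terms cancel because `twist a` and multiplication by an element of degree `b` commute up to
`θ(a, b)`. -/
theorem primOp_mul {a b : G} {x y : L} (hx : x ∈ A.piece a) (hy : y ∈ A.piece b) :
    A.primOp a x * A.primOp b y
      = A.primOp (a + b) (A.bracket x y) + (θ.val a b : ℂ) • (A.primOp b y * A.primOp a x) := by
  have hθ : (θ.val a b : ℂ) * θ.val b a = 1 := by
    rw [← Units.val_mul, θ.skew, Units.val_one]
  apply TensorProduct.ext'
  intro p q
  simp only [LinearMap.add_apply, LinearMap.smul_apply, Module.End.mul_apply, primOp_tmul, map_add,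
    map_mul, A.twist_toEnv _ hx, A.twist_toEnv _ hy, A.twist_add, ← A.toEnv_bracket hx hy,
    smul_mul_assoc, TensorProduct.smul_tmul', sub_mul, mul_assoc, TensorProduct.sub_tmul,
    TensorProduct.tmul_sub, smul_add, smul_smul, hθ, one_smul, TensorProduct.tmul_smul,
    add_comm b a]
  abel

/-- The coproduct of the universal enveloping algebra. The color tensor square is encoded through
its faithful action on the underlying tensor product, so that the coproduct is an algebra
homomorphism into linear operators. -/
noncomputable def coprodOp : A.Env →ₐ[ℂ] Module.End ℂ (A.Env ⊗[ℂ] A.Env) :=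
  A.lift (A.isInternal.glue A.primOp) (by
    intro a b x y hx hy
    rw [A.isInternal.glue_apply _ hx, A.isInternal.glue_apply _ hy,
      A.isInternal.glue_apply _ (A.bracket_mem hx hy),
      ← A.primOp_mul hx hy])

theorem coprodOp_toEnv {a : G} {x : L} (hx : x ∈ A.piece a) :
    A.coprodOp (A.toEnv x) = A.primOp a x := by
  simp [coprodOp, A.isInternal.glue_apply _ hx]

/-- The coproduct as a linear map into the tensor square. -/
noncomputable def coprod : A.Env →ₗ[ℂ] A.Env ⊗[ℂ] A.Env :=
  LinearMap.applyₗ (1 ⊗ₜ 1) ∘ₗ A.coprodOp.toLinearMap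

theorem coprod_one : A.coprod 1 = 1 ⊗ₜ 1 := by simp [coprod]

theorem coprod_toEnv_mul {a : G} {x : L} (hx : x ∈ A.piece a) (u : A.Env) :
    A.coprod (A.toEnv x * u) = A.primOp a x (A.coprod u) := by
  simp [coprod, A.coprodOp_toEnv hx]

/-! ### The standard filtration -/

/-- The subspace of the universal enveloping algebra spanned by products of at most `n` elements
of the color Lie algebra. -/
noncomputable def filt (n : ℕ) : Submodule ℂ A.Env := (1 ⊔ LinearMap.range A.toEnv) ^ n

theorem one_mem_filt (n : ℕ) : (1 : A.Env) ∈ A.filt n :=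
  Submodule.one_le.1 (one_le_pow₀ (M₀ := Submodule ℂ A.Env) le_sup_left)

theorem filt_mono {m n : ℕ} (h : m ≤ n) : A.filt m ≤ A.filt n :=
  pow_le_pow_right₀ (M₀ := Submodule ℂ A.Env) le_sup_left h

theorem mul_mem_filt {m n : ℕ} {u v : A.Env} (hu : u ∈ A.filt m) (hv : v ∈ A.filt n) :
    u * v ∈ A.filt (m + n) := by
  rw [filt, pow_add]
  exact Submodule.mul_mem_mul hu hv

theorem toEnv_mem_filt (x : L) : A.toEnv x ∈ A.filt 1 := by
  rw [filt, pow_one]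
  exact Submodule.mem_sup_right ⟨x, rfl⟩

theorem toEnv_mul_mem_filt (x : L) {n : ℕ} {u : A.Env} (hu : u ∈ A.filt n) :
    A.toEnv x * u ∈ A.filt (n + 1) := by
  rw [add_comm]
  exact A.mul_mem_filt (A.toEnv_mem_filt x) hu

theorem filt_zero_le {N : Submodule ℂ A.Env} (h : 1 ∈ N) : A.filt 0 ≤ N := by
  rw [filt, pow_zero]
  exact Submodule.one_le.2 h

/-- The induction principle for the filtration. -/
theorem filt_succ_le {n : ℕ} {N : Submodule ℂ A.Env} (h₀ : A.filt n ≤ N)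
    (h₁ : ∀ (a : G) (x : L) (u : A.Env), x ∈ A.piece a → u ∈ A.filt n → A.toEnv x * u ∈ N) :
    A.filt (n + 1) ≤ N := by
  rw [filt, pow_succ', Submodule.mul_le]
  intro w hw u hu
  obtain ⟨c, hc, _, ⟨x, rfl⟩, rfl⟩ := Submodule.mem_sup.1 hw
  obtain ⟨c, rfl⟩ := Submodule.mem_one.1 hc
  rw [add_mul, ← Algebra.smul_def]
  refine N.add_mem (N.smul_mem _ (h₀ hu)) ?_
  exact A.le_of_piece_le (N := N.comap ((LinearMap.mul ℂ A.Env).flip u ∘ₗ A.toEnv))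
    (fun a x hx => h₁ a x u hx hu) x

theorem exists_mem_filt (u : A.Env) : ∃ n, u ∈ A.filt n := by
  have hu : u ∈ Algebra.adjoin ℂ (Set.range A.toEnv) := by
    rw [A.adjoin_range_toEnv]
    trivial
  induction hu using Algebra.adjoin_induction with
  | mem x hx =>
    obtain ⟨x, rfl⟩ := hx
    exact ⟨1, A.toEnv_mem_filt x⟩
  | algebraMap r =>
    refine ⟨0, ?_⟩
    rw [Algebra.algebraMap_eq_smul_one]
    exact Submodule.smul_mem _ _ (A.one_mem_filt 0)
  | add x y _ _ hx hy =>
    obtain ⟨m, hm⟩ := hx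
    obtain ⟨n, hn⟩ := hy
    exact ⟨m + n, Submodule.add_mem _ (A.filt_mono (by omega) hm) (A.filt_mono (by omega) hn)⟩
  | mul x y _ _ hx hy =>
    obtain ⟨m, hm⟩ := hx
    obtain ⟨n, hn⟩ := hy
    exact ⟨m + n, A.mul_mem_filt hm hn⟩

theorem twist_mem_filt (a : G) {n : ℕ} {u : A.Env} (hu : u ∈ A.filt n) :
    A.twist a u ∈ A.filt n := by
  suffices A.filt n ≤ (A.filt n).comap (A.twist a).toLinearMap from this hu
  clear hu
  induction n with
  | zero => exact A.filt_zero_le (by simpa using A.one_mem_filt 0)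
  | succ n ih =>
    refine A.filt_succ_le (ih.trans (Submodule.comap_mono (A.filt_mono n.le_succ))) ?_
    intro b x u hx hu
    simp only [Submodule.mem_comap, AlgHom.toLinearMap_apply, map_mul, A.twist_toEnv _ hx,
      smul_mul_assoc]
    exact Submodule.smul_mem _ _ (A.toEnv_mul_mem_filt x (ih hu))

/-- The associated graded algebra of the filtration is color commutative. -/
theorem twist_mul_sub_mem_filt {a : G} {x : L} (hx : x ∈ A.piece a) {n : ℕ} {u : A.Env}
    (hu : u ∈ A.filt n) : A.twist a u * A.toEnv x - A.toEnv x * u ∈ A.filt n := by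
  suffices A.filt n ≤ (A.filt n).comap ((LinearMap.mul ℂ A.Env).flip (A.toEnv x) ∘ₗ
      (A.twist a).toLinearMap - LinearMap.mul ℂ A.Env (A.toEnv x)) from this hu
  clear hu
  induction n with
  | zero => exact A.filt_zero_le (by simp)
  | succ n ih =>
    refine A.filt_succ_le (ih.trans (Submodule.comap_mono (A.filt_mono n.le_succ))) ?_
    intro b y u hy hu
    have key : A.twist a (A.toEnv y * u) * A.toEnv x - A.toEnv x * (A.toEnv y * u)
        = (θ.val a b : ℂ) • (A.toEnv y * (A.twist a u * A.toEnv x - A.toEnv x * u))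
          - A.toEnv (A.bracket x y) * u := by
      rw [← A.toEnv_bracket hx hy, map_mul, A.twist_toEnv _ hy]
      simp only [smul_mul_assoc, mul_sub, sub_mul, smul_sub, mul_assoc]
      abel
    simp only [Submodule.mem_comap, LinearMap.sub_apply, LinearMap.comp_apply,
      LinearMap.flip_apply, LinearMap.mul_apply', AlgHom.toLinearMap_apply]
    rw [key]
    exact Submodule.sub_mem _ (Submodule.smul_mem _ _ (A.toEnv_mul_mem_filt y (ih hu)))
      (A.toEnv_mul_mem_filt _ hu)

/-- The total filtration of the tensor square. -/
noncomputable def tensorFilt (n : ℕ) : Submodule ℂ (A.Env ⊗[ℂ] A.Env) :=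
  Submodule.span ℂ {t | ∃ i j p q, i + j ≤ n ∧ p ∈ A.filt i ∧ q ∈ A.filt j ∧ t = p ⊗ₜ q}

theorem primOp_mem_tensorFilt (a : G) (x : L) {n : ℕ} {t : A.Env ⊗[ℂ] A.Env}
    (ht : t ∈ A.tensorFilt n) : A.primOp a x t ∈ A.tensorFilt (n + 1) := by
  suffices A.tensorFilt n ≤ (A.tensorFilt (n + 1)).comap (A.primOp a x) from this ht
  refine Submodule.span_le.2 ?_
  rintro _ ⟨i, j, p, q, hij, hp, hq, rfl⟩
  simp only [SetLike.mem_coe, Submodule.mem_comap, primOp_tmul]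
  refine Submodule.add_mem _ (Submodule.subset_span ?_) (Submodule.subset_span ?_)
  · exact ⟨i + 1, j, _, _, by omega, A.toEnv_mul_mem_filt x hp, hq, rfl⟩
  · exact ⟨i, j + 1, _, _, by omega, A.twist_mem_filt a hp, A.toEnv_mul_mem_filt x hq, rfl⟩

/-- The coproduct preserves the filtration. -/
theorem coprod_mem_tensorFilt {n : ℕ} {u : A.Env} (hu : u ∈ A.filt n) :
    A.coprod u ∈ A.tensorFilt n := by
  suffices A.filt n ≤ (A.tensorFilt n).comap A.coprod from this hu
  clear hu
  induction n with
  | zero =>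
    refine A.filt_zero_le ?_
    rw [Submodule.mem_comap, coprod_one]
    exact Submodule.subset_span ⟨0, 0, 1, 1, le_rfl, A.one_mem_filt 0, A.one_mem_filt 0, rfl⟩
  | succ n ih =>
    refine A.filt_succ_le (ih.trans (Submodule.comap_mono (Submodule.span_mono ?_))) ?_
    · rintro _ ⟨i, j, p, q, hij, h⟩
      exact ⟨i, j, p, q, by omega, h⟩
    · intro a x u hx hu
      rw [Submodule.mem_comap, A.coprod_toEnv_mul hx]
      exact A.primOp_mem_tensorFilt a x (ih hu)

/-- On a pure tensor `p ⊗ q` the two terms of `primOp a x` multiply to `x p q` and, after moving `x`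
to the front, to `x p q` again modulo lower terms. -/
theorem mul_primOp_sub_mem_filt {a : G} {x : L} (hx : x ∈ A.piece a) {n : ℕ}
    {t : A.Env ⊗[ℂ] A.Env} (ht : t ∈ A.tensorFilt n) :
    LinearMap.mul' ℂ A.Env (A.primOp a x t) - (2 : ℂ) • (A.toEnv x * LinearMap.mul' ℂ A.Env t)
      ∈ A.filt n := by
  suffices A.tensorFilt n ≤ (A.filt n).comap (LinearMap.mul' ℂ A.Env ∘ₗ A.primOp a x
      - (2 : ℂ) • (LinearMap.mul ℂ A.Env (A.toEnv x) ∘ₗ LinearMap.mul' ℂ A.Env)) from this ht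
  refine Submodule.span_le.2 ?_
  rintro _ ⟨i, j, p, q, hij, hp, hq, rfl⟩
  have key : A.toEnv x * p * q + A.twist a p * (A.toEnv x * q) - (2 : ℂ) • (A.toEnv x * (p * q))
      = (A.twist a p * A.toEnv x - A.toEnv x * p) * q := by
    simp only [two_smul, sub_mul, mul_assoc]
    abel
  simp only [SetLike.mem_coe, Submodule.mem_comap, LinearMap.sub_apply, LinearMap.comp_apply,
    LinearMap.smul_apply, primOp_tmul, map_add, LinearMap.mul'_apply, LinearMap.mul_apply']
  rw [key]
  exact A.filt_mono hij (A.mul_mem_filt (A.twist_mul_sub_mem_filt hx hp) hq)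

theorem mul_coprod_mem_filt {n : ℕ} {u : A.Env} (hu : u ∈ A.filt n) :
    LinearMap.mul' ℂ A.Env (A.coprod u) ∈ A.filt n := by
  suffices A.tensorFilt n ≤ (A.filt n).comap (LinearMap.mul' ℂ A.Env) from
    this (A.coprod_mem_tensorFilt hu)
  refine Submodule.span_le.2 ?_
  rintro _ ⟨i, j, p, q, hij, hp, hq, rfl⟩
  exact A.filt_mono hij (A.mul_mem_filt hp hq)

/-- Multiplication after the coproduct acts as `2 ^ n` on the `n`-th graded piece of the
filtration: a product of `n` elements is split in `2 ^ n` ways, and each of them gives back the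
same product up to lower terms. -/
theorem mul_coprod_sub_mem_filt {n : ℕ} {u : A.Env} (hu : u ∈ A.filt (n + 1)) :
    LinearMap.mul' ℂ A.Env (A.coprod u) - (2 : ℂ) ^ (n + 1) • u ∈ A.filt n := by
  suffices ∀ n, A.filt (n + 1) ≤ (A.filt n).comap (LinearMap.mul' ℂ A.Env ∘ₗ A.coprod
      - (2 : ℂ) ^ (n + 1) • LinearMap.id) from this n hu
  clear hu u n
  have step : ∀ (n : ℕ) (a : G) (x : L) (u : A.Env), x ∈ A.piece a → u ∈ A.filt n →
      A.toEnv x * (LinearMap.mul' ℂ A.Env (A.coprod u) - (2 : ℂ) ^ n • u) ∈ A.filt n →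
      A.toEnv x * u ∈ (A.filt n).comap (LinearMap.mul' ℂ A.Env ∘ₗ A.coprod
        - (2 : ℂ) ^ (n + 1) • LinearMap.id) := by
    intro n a x u hx hu h
    have h' := Submodule.add_mem _ (A.mul_primOp_sub_mem_filt hx (A.coprod_mem_tensorFilt hu))
      (Submodule.smul_mem _ (2 : ℂ) h)
    simp only [Submodule.mem_comap, LinearMap.sub_apply, LinearMap.comp_apply,
      LinearMap.smul_apply, LinearMap.id_apply, A.coprod_toEnv_mul hx]
    convert h' using 1
    rw [mul_sub, smul_sub, mul_smul_comm, smul_smul, ← pow_succ']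
    abel
  intro n
  induction n with
  | zero =>
    refine A.filt_succ_le (fun u hu => Submodule.sub_mem _ (A.mul_coprod_mem_filt hu)
      (Submodule.smul_mem _ _ hu)) fun a x u hx hu => step _ a x u hx hu ?_
    have : A.filt 0 ≤ LinearMap.ker (LinearMap.mul' ℂ A.Env ∘ₗ A.coprod
      - (2 : ℂ) ^ 0 • LinearMap.id) := A.filt_zero_le (by simp [coprod_one])
    have h0 := LinearMap.mem_ker.1 (this hu)
    simp only [LinearMap.sub_apply, LinearMap.comp_apply, LinearMap.smul_apply,
      LinearMap.id_apply] at h0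
    rw [h0, mul_zero]
    exact Submodule.zero_mem _
  | succ n ih =>
    refine A.filt_succ_le (fun u hu => Submodule.sub_mem _ (A.mul_coprod_mem_filt hu)
      (Submodule.smul_mem _ _ hu)) fun a x u hx hu => step _ a x u hx hu ?_
    refine A.toEnv_mul_mem_filt x (ih hu)

/-- Up to terms of lower filtration degree in both factors, every element is primitive. -/
theorem coprod_sub_mem_range {n : ℕ} {u : A.Env} (hu : u ∈ A.filt (n + 1)) :
    A.coprod u - u ⊗ₜ 1 - 1 ⊗ₜ u
      ∈ LinearMap.range (TensorProduct.mapIncl (A.filt n) (A.filt n)) := by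
  have mem : ∀ {n p q}, p ∈ A.filt n → q ∈ A.filt n →
      p ⊗ₜ[ℂ] q ∈ LinearMap.range (TensorProduct.mapIncl (A.filt n) (A.filt n)) :=
    fun hp hq => ⟨⟨_, hp⟩ ⊗ₜ ⟨_, hq⟩, by simp [TensorProduct.mapIncl]⟩
  have prim : ∀ (a : G) (x : L) (n : ℕ) (t : A.Env ⊗[ℂ] A.Env),
      t ∈ LinearMap.range (TensorProduct.mapIncl (A.filt n) (A.filt n)) → A.primOp a x t ∈
        LinearMap.range (TensorProduct.mapIncl (A.filt (n + 1)) (A.filt (n + 1))) := by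
    rintro a x n _ ⟨t, rfl⟩
    induction t with
    | zero => simp
    | add t t' h h' =>
      rw [map_add, map_add]
      exact Submodule.add_mem _ h h'
    | tmul p q =>
      simp only [TensorProduct.mapIncl, TensorProduct.map_tmul, Submodule.subtype_apply,
        primOp_tmul]
      exact Submodule.add_mem _
        (mem (A.toEnv_mul_mem_filt x p.2) (A.filt_mono n.le_succ q.2))
        (mem (A.twist_mem_filt a (A.filt_mono n.le_succ p.2)) (A.toEnv_mul_mem_filt x q.2))
  have mono : ∀ n, LinearMap.range (TensorProduct.mapIncl (A.filt n) (A.filt n)) ≤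
      LinearMap.range (TensorProduct.mapIncl (A.filt (n + 1)) (A.filt (n + 1))) := by
    rintro n _ ⟨t, rfl⟩
    induction t with
    | zero => simp
    | add t t' h h' =>
      rw [map_add]
      exact Submodule.add_mem _ h h'
    | tmul p q => exact mem (A.filt_mono n.le_succ p.2) (A.filt_mono n.le_succ q.2)
  let D : A.Env →ₗ[ℂ] A.Env ⊗[ℂ] A.Env :=
    A.coprod - (TensorProduct.mk ℂ A.Env A.Env).flip 1 - TensorProduct.mk ℂ A.Env A.Env 1
  suffices ∀ n, A.filt (n + 1) ≤
      (LinearMap.range (TensorProduct.mapIncl (A.filt n) (A.filt n))).comap D from this n hu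
  clear hu u n
  have zero : A.filt 0 ≤
      (LinearMap.range (TensorProduct.mapIncl (A.filt 0) (A.filt 0))).comap D := by
    refine A.filt_zero_le ?_
    have : D 1 = -(1 ⊗ₜ 1) := by simp [D, coprod_one]
    rw [Submodule.mem_comap, this]
    exact Submodule.neg_mem _ (mem (A.one_mem_filt 0) (A.one_mem_filt 0))
  intro n
  induction n with
  | zero =>
    -- elements of the Lie algebra are primitive on the nose; the general step would need `x` itself
    -- to lie in the lower filtration subspace
    refine A.filt_succ_le zero fun a x u hx hu => ?_
    suffices A.filt 0 ≤ LinearMap.ker (D ∘ₗ LinearMap.mul ℂ A.Env (A.toEnv x)) by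
      have h : D (A.toEnv x * u) = 0 := this hu
      rw [Submodule.mem_comap, h]
      exact Submodule.zero_mem _
    refine A.filt_zero_le ?_
    have : A.coprod (A.toEnv x * 1) = _ := A.coprod_toEnv_mul hx 1
    simp [D, -mul_one, this, coprod_one, primOp_tmul]
  | succ n ih =>
    refine A.filt_succ_le (ih.trans (Submodule.comap_mono (mono n))) fun a x u hx hu => ?_
    have key : D (A.toEnv x * u) = A.primOp a x (D u) + A.twist a u ⊗ₜ A.toEnv x
        + A.toEnv x ⊗ₜ u := by
      simp only [D, LinearMap.sub_apply, LinearMap.flip_apply, TensorProduct.mk_apply,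
        A.coprod_toEnv_mul hx, map_sub, primOp_tmul, map_one, mul_one]
      abel
    have hx' := A.filt_mono (show 1 ≤ n + 1 by omega) (A.toEnv_mem_filt x)
    rw [Submodule.mem_comap, key]
    exact Submodule.add_mem _ (Submodule.add_mem _ (prim a x n _ (ih hu))
      (mem (A.twist_mem_filt a hu) hx')) (mem hx' hu)

/-! ### Injectivity of induced homomorphisms -/

variable {G' : Type*} [AddCommGroup G'] [DecidableEq G'] {θ' : CommutationFactor G'}
  {L' : Type*} [AddCommGroup L'] [Module ℂ L'] (A' : ColorLieAlgebra θ' L')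

/-- A homomorphism of universal enveloping algebras that is induced by a morphism of color Lie
algebras `j` over a map `φ` of grading groups is injective, provided that it is injective on the
first color Lie algebra. -/
theorem injective_of_injective_toEnv (φ : G → G') (hφ : ∀ a b, θ'.val (φ a) (φ b) = θ.val a b)
    (j : L →ₗ[ℂ] L') (hj : ∀ a x, x ∈ A.piece a → j x ∈ A'.piece (φ a))
    (f : A.Env →ₐ[ℂ] A'.Env) (hf : ∀ x, f (A.toEnv x) = A'.toEnv (j x))
    (hinj : Function.Injective fun x => A'.toEnv (j x)) : Function.Injective f := by
  have htwist : ∀ a u, f (A.twist a u) = A'.twist (φ a) (f u) := by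
    intro a u
    refine DFunLike.congr_fun (f := f.comp (A.twist a)) (g := (A'.twist (φ a)).comp f) ?_ u
    refine A.hom_ext fun b x hx => ?_
    simp [A.twist_toEnv a hx, hf, A'.twist_toEnv _ (hj b x hx), hφ]
  have hprim : ∀ a x t, TensorProduct.map f.toLinearMap f.toLinearMap (A.primOp a x t)
      = A'.primOp (φ a) (j x) (TensorProduct.map f.toLinearMap f.toLinearMap t) := by
    intro a x t
    induction t with
    | zero => simp
    | add t t' h h' => simp only [map_add, h, h']
    | tmul p q => simp [primOp_tmul, hf, htwist]
  have hcoprod : ∀ u, TensorProduct.map f.toLinearMap f.toLinearMap (A.coprod u)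
      = A'.coprod (f u) := by
    intro u
    obtain ⟨n, hu⟩ := A.exists_mem_filt u
    suffices ∀ n, A.filt n ≤ LinearMap.eqLocus
        (TensorProduct.map f.toLinearMap f.toLinearMap ∘ₗ A.coprod)
        (A'.coprod ∘ₗ f.toLinearMap) from this n hu
    clear hu n
    intro n
    induction n with
    | zero => exact A.filt_zero_le (by simp [coprod_one])
    | succ n ih =>
      refine A.filt_succ_le ih fun a x u hx hu => ?_
      have h := ih hu
      simp only [LinearMap.mem_eqLocus, LinearMap.comp_apply, AlgHom.toLinearMap_apply] at h ⊢
      rw [A.coprod_toEnv_mul hx, hprim, h, map_mul, hf, A'.coprod_toEnv_mul (hj a x hx)]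
  suffices ∀ n, Disjoint (A.filt n) (LinearMap.ker f.toLinearMap) by
    refine (injective_iff_map_eq_zero f).2 fun u hu => ?_
    obtain ⟨n, hn⟩ := A.exists_mem_filt u
    exact Submodule.disjoint_def.1 (this n) u hn hu
  intro n
  rw [Submodule.disjoint_def]
  -- on the first filtration step, the counit separates the scalars from the Lie algebra
  have one : ∀ u ∈ A.filt 1, f u = 0 → u = 0 := by
    intro u hu h
    rw [filt, pow_one] at hu
    obtain ⟨c, hc, _, ⟨x, rfl⟩, rfl⟩ := Submodule.mem_sup.1 hu
    obtain ⟨c, rfl⟩ := Submodule.mem_one.1 hc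
    rw [map_add, AlgHom.commutes, hf] at h
    have hc0 := congrArg A'.counit h
    simp only [map_add, AlgHom.commutes, counit_toEnv, add_zero, map_zero,
      Algebra.algebraMap_self, RingHom.id_apply] at hc0
    subst hc0
    rw [map_zero, zero_add] at h
    have hx : x = 0 := hinj (by simpa using h)
    simp [hx]
  induction n with
  | zero => exact fun u hu h => one u (A.filt_mono zero_le_one hu) h
  | succ n ih =>
    obtain rfl | hn := Nat.eq_zero_or_pos n
    · exact one
    intro u hu h
    have h : f u = 0 := h
    -- an element of the kernel is primitive, since `f ⊗ f` is injective on the lower terms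
    have hfn : Function.Injective (f.toLinearMap ∘ₗ (A.filt n).subtype) := by
      rw [injective_iff_map_eq_zero]
      exact fun v hv => Subtype.ext (ih v v.2 hv)
    have hprimitive : A.coprod u - u ⊗ₜ 1 - 1 ⊗ₜ u = 0 := by
      obtain ⟨t, ht⟩ := A.coprod_sub_mem_range hu
      have h0 : TensorProduct.map f.toLinearMap f.toLinearMap (A.coprod u - u ⊗ₜ 1 - 1 ⊗ₜ u)
          = 0 := by
        simp [hcoprod, h]
      rw [← ht, TensorProduct.mapIncl, ← LinearMap.comp_apply, ← TensorProduct.map_comp] at h0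
      have ht0 : t = 0 := by
        refine TensorProduct.map_injective_of_flat_flat _ _ hfn hfn ?_
        rw [h0, map_zero]
      rw [← ht, ht0, map_zero]
    -- multiplication after the coproduct maps `u` to `2 u`, and to `2 ^ (n + 1) u` up to lower
    -- terms, so that `u` itself is a lower term
    have hmul := A.mul_coprod_sub_mem_filt hu
    have h2 : LinearMap.mul' ℂ A.Env (A.coprod u) = (2 : ℂ) • u := by
      rw [sub_sub, sub_eq_zero] at hprimitive
      rw [hprimitive, map_add, LinearMap.mul'_apply, LinearMap.mul'_apply, mul_one, one_mul,
        two_smul]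
    rw [h2, ← sub_smul] at hmul
    have hne : (2 : ℂ) - 2 ^ (n + 1) ≠ 0 := by
      rw [pow_succ', sub_ne_zero]
      intro h
      have h1 : ((2 : ℕ) : ℂ) ^ n = 1 := by
        have := mul_left_cancel₀ two_ne_zero ((mul_one (2 : ℂ)).trans h)
        exact_mod_cast this.symm
      have h1' : 2 ^ n = 1 := by exact_mod_cast h1
      have := Nat.one_lt_two_pow hn.ne'
      omega
    exact ih u ((Submodule.smul_mem_iff _ hne).1 hmul) h

end ColorLieAlgebra

/-! ### Color Lie algebras of graded subspaces of an associative algebra -/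

section ColorBracket

variable {G : Type*} [AddCommGroup G] (θ : CommutationFactor G)

theorem CommutationFactor.coe_mul_coe (a b : G) : (θ.val a b : ℂ) * θ.val b a = 1 := by
  rw [← Units.val_mul, θ.skew, Units.val_one]

variable {P : Type*} [Ring P] [Algebra ℂ P]

/-- The color bracket of two elements of an associative algebra, of degrees `a` and `b`. -/
def colorBracket (a b : G) (x y : P) : P := x * y - (θ.val a b : ℂ) • (y * x)

theorem colorBracket_antisymm (a b : G) (x y : P) :
    colorBracket θ a b x y = -((θ.val a b : ℂ) • colorBracket θ b a y x) := by
  simp only [colorBracket, smul_sub, smul_smul, θ.coe_mul_coe, one_smul, neg_sub]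

theorem colorBracket_leibniz (a b c : G) (x y z : P) :
    colorBracket θ a (b + c) x (colorBracket θ b c y z)
      = colorBracket θ (a + b) c (colorBracket θ a b x y) z
        + (θ.val a b : ℂ) • colorBracket θ b (a + c) y (colorBracket θ a c x z) := by
  simp only [colorBracket, θ.add_left, θ.add_right, Units.val_mul, mul_sub, sub_mul,
    smul_mul_assoc, mul_smul_comm, mul_assoc, smul_sub, smul_smul]
  have h := θ.coe_mul_coe a b
  match_scalars
  · ring
  · linear_combination (θ.val b c : ℂ) * h
  · ring
  · ring
  · ring
  · linear_combination (-(θ.val b c : ℂ) * θ.val a c) * h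

theorem colorBracket_jacobi (a b c : G) (x y z : P) :
    (θ.val c a : ℂ) • colorBracket θ a (b + c) x (colorBracket θ b c y z)
      + (θ.val b c : ℂ) • colorBracket θ c (a + b) z (colorBracket θ a b x y)
      + (θ.val a b : ℂ) • colorBracket θ b (c + a) y (colorBracket θ c a z x) = 0 := by
  simp only [colorBracket, θ.add_right, Units.val_mul, mul_sub, sub_mul,
    smul_mul_assoc, mul_smul_comm, mul_assoc, smul_sub, smul_smul]
  have h₁ := θ.coe_mul_coe a b
  have h₂ := θ.coe_mul_coe b c
  have h₃ := θ.coe_mul_coe c a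
  match_scalars
  · linear_combination -(θ.val c a : ℂ) * h₂
  · linear_combination (θ.val b c * θ.val c a : ℂ) * h₁
  · linear_combination -(θ.val a b : ℂ) * h₃
  · linear_combination (θ.val a b * θ.val b c : ℂ) * h₃
  · linear_combination -(θ.val b c : ℂ) * h₁
  · linear_combination (θ.val a b * θ.val c a : ℂ) * h₂

end ColorBracket

namespace ColorLieAlgebra

variable {G : Type*} [AddCommGroup G] [DecidableEq G] (θ : CommutationFactor G)
  {P : Type*} [Ring P] [Algebra ℂ P] (𝒜 : G → Submodule ℂ P) (W : Submodule ℂ P)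

variable {𝒜 W} in
omit [AddCommGroup G] in
theorem isInternal_comap_subtype (hW : ⨆ a, 𝒜 a = W) (h𝒜 : iSupIndep 𝒜) :
    DirectSum.IsInternal fun a => (𝒜 a).comap W.subtype := by
  have hle : ∀ a, 𝒜 a ≤ W := fun a => hW ▸ le_iSup 𝒜 a
  have hmap : ∀ a, ((𝒜 a).comap W.subtype).map W.subtype = 𝒜 a := fun a => by
    rw [Submodule.map_comap_subtype, inf_of_le_right (hle a)]
  refine (DirectSum.isInternal_submodule_iff_iSupIndep_and_iSup_eq_top _).2 ⟨?_, ?_⟩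
  · have : (W.mapIic ∘ fun a => (𝒜 a).comap W.subtype) = fun a => ⟨𝒜 a, hle a⟩ := by
      ext a m
      change m ∈ ((𝒜 a).comap W.subtype).map W.subtype ↔ _
      rw [hmap]
    rw [← iSupIndep_map_orderIso_iff W.mapIic, this]
    exact .of_coe_Iic_comp h𝒜
  · apply Submodule.map_injective_of_injective W.injective_subtype
    simp only [Submodule.map_iSup, hmap, hW, Submodule.map_top, Submodule.range_subtype]

variable (hW : ⨆ a, 𝒜 a = W) (h𝒜 : iSupIndep 𝒜)

/-- The bilinear map on the sum of the subspaces `𝒜 a` that is given by the color bracket on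
homogeneous elements. -/
noncomputable def bracketAux : W →ₗ[ℂ] W →ₗ[ℂ] P :=
  (isInternal_comap_subtype hW h𝒜).glue fun a =>
    ((isInternal_comap_subtype hW h𝒜).glue fun b =>
      ((LinearMap.mul ℂ P).flip - (θ.val a b : ℂ) • LinearMap.mul ℂ P).compl₁₂
        W.subtype W.subtype).flip

theorem bracketAux_apply {a b : G} {x y : W} (hx : (x : P) ∈ 𝒜 a) (hy : (y : P) ∈ 𝒜 b) :
    bracketAux θ 𝒜 W hW h𝒜 x y = colorBracket θ a b (x : P) y := by
  rw [bracketAux, (isInternal_comap_subtype hW h𝒜).glue_apply _ (a := a) hx, LinearMap.flip_apply,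
    (isInternal_comap_subtype hW h𝒜).glue_apply _ (a := b) hy]
  simp [colorBracket]

variable (hb : ∀ (a b : G) (x y : P), x ∈ 𝒜 a → y ∈ 𝒜 b → colorBracket θ a b x y ∈ 𝒜 (a + b))

include hb in
theorem bracketAux_mem (x y : W) : bracketAux θ 𝒜 W hW h𝒜 x y ∈ W := by
  have htop := (isInternal_comap_subtype hW h𝒜).submodule_iSup_eq_top
  have h : ∀ a, ∀ x ∈ (𝒜 a).comap W.subtype, ∀ y, bracketAux θ 𝒜 W hW h𝒜 x y ∈ W := by
    intro a x hx y
    have : (⊤ : Submodule ℂ W) ≤ W.comap (bracketAux θ 𝒜 W hW h𝒜 x) := by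
      rw [← htop, iSup_le_iff]
      intro b y hy
      rw [Submodule.mem_comap, bracketAux_apply θ 𝒜 W hW h𝒜 hx hy]
      exact hW.le (Submodule.mem_iSup_of_mem _ (hb a b _ _ hx hy))
    exact this trivial
  have : (⊤ : Submodule ℂ W) ≤ W.comap ((bracketAux θ 𝒜 W hW h𝒜).flip y) := by
    rw [← htop, iSup_le_iff]
    exact fun a x hx => h a x hx y
  exact this trivial

/-- The color Lie algebra formed by a direct sum of subspaces of an associative algebra that are
closed under the color bracket. -/
noncomputable def ofSubspaces : ColorLieAlgebra θ W :=
  have key : ∀ {a b : G} {x y : W}, (x : P) ∈ 𝒜 a → (y : P) ∈ 𝒜 b →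
      bracketAux θ 𝒜 W hW h𝒜 x y = colorBracket θ a b (x : P) y :=
    bracketAux_apply θ 𝒜 W hW h𝒜
  have hmem : ∀ {a b : G} {x y : W}, (x : P) ∈ 𝒜 a → (y : P) ∈ 𝒜 b →
      bracketAux θ 𝒜 W hW h𝒜 x y ∈ 𝒜 (a + b) := fun hx hy => by
    rw [key hx hy]
    exact hb _ _ _ _ hx hy
  { piece := fun a => (𝒜 a).comap W.subtype
    isInternal := isInternal_comap_subtype hW h𝒜
    bracket := LinearMap.mk₂ ℂ
      (fun x y => ⟨bracketAux θ 𝒜 W hW h𝒜 x y, bracketAux_mem θ 𝒜 W hW h𝒜 hb x y⟩)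
      (fun _ _ _ => Subtype.ext (by simp)) (fun _ _ _ => Subtype.ext (by simp))
      (fun _ _ _ => Subtype.ext (by simp)) (fun _ _ _ => Subtype.ext (by simp))
    bracket_mem := hmem
    antisymm := fun {a b x y} hx hy => Subtype.ext (by
      simp only [LinearMap.mk₂_apply, Submodule.coe_neg, Submodule.coe_smul]
      rw [key hx hy, key hy hx]
      exact colorBracket_antisymm θ a b _ _)
    jacobi := fun {a b c x y z} hx hy hz => Subtype.ext (by
      simp only [LinearMap.mk₂_apply, Submodule.coe_add, Submodule.coe_smul, Submodule.coe_zero]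
      have h₁ := key (y := ⟨_, bracketAux_mem θ 𝒜 W hW h𝒜 hb y z⟩) hx (hmem hy hz)
      have h₂ := key (y := ⟨_, bracketAux_mem θ 𝒜 W hW h𝒜 hb x y⟩) hz (hmem hx hy)
      have h₃ := key (y := ⟨_, bracketAux_mem θ 𝒜 W hW h𝒜 hb z x⟩) hy (hmem hz hx)
      simp only [key hx hy, key hy hz, key hz hx] at h₁ h₂ h₃ ⊢
      rw [h₁, h₂, h₃]
      exact colorBracket_jacobi θ a b c _ _ _) }

theorem coe_ofSubspaces_bracket {a b : G} {x y : W} (hx : (x : P) ∈ 𝒜 a) (hy : (y : P) ∈ 𝒜 b) :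
    (((ofSubspaces θ 𝒜 W hW h𝒜 hb).bracket x y : W) : P) = colorBracket θ a b (x : P) y :=
  bracketAux_apply θ 𝒜 W hW h𝒜 hx hy

/-- The homomorphism from the universal enveloping algebra to the ambient associative algebra. -/
noncomputable def ofSubspacesHom : (ofSubspaces θ 𝒜 W hW h𝒜 hb).Env →ₐ[ℂ] P :=
  (ofSubspaces θ 𝒜 W hW h𝒜 hb).lift W.subtype (by
    intro a b x y hx hy
    rw [Submodule.subtype_apply, Submodule.subtype_apply, Submodule.subtype_apply,
      coe_ofSubspaces_bracket θ 𝒜 W hW h𝒜 hb hx hy, colorBracket, sub_add_cancel])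

theorem ofSubspacesHom_toEnv (x : W) :
    ofSubspacesHom θ 𝒜 W hW h𝒜 hb ((ofSubspaces θ 𝒜 W hW h𝒜 hb).toEnv x) = x := by
  simp [ofSubspacesHom]

theorem range_ofSubspacesHom :
    (ofSubspacesHom θ 𝒜 W hW h𝒜 hb).range = Algebra.adjoin ℂ (W : Set P) := by
  rw [← Algebra.map_top, ← adjoin_range_toEnv, AlgHom.map_adjoin, ← Set.range_comp]
  congr 1
  ext p
  constructor
  · rintro ⟨x, rfl⟩
    rw [Function.comp_apply, ofSubspacesHom_toEnv]
    exact x.2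
  · exact fun hp => ⟨⟨p, hp⟩, ofSubspacesHom_toEnv θ 𝒜 W hW h𝒜 hb ⟨p, hp⟩⟩

end ColorLieAlgebra

namespace RelParabose

/-! ### The relations of the relative parabose set -/

variable {ι κ : Type*} [DecidableEq ι] [DecidableEq κ]

theorem commut_anticommut_B_B_B (i j k : ι) (ξ η ε : ℤˣ) :
    commut (anticommut (B κ i ξ) (B κ j η)) (B κ k ε)
      = ((sgn ε - sgn η) * kron j k) • B κ i ξ + ((sgn ε - sgn ξ) * kron i k) • B κ j η := by
  simpa [commut, anticommut, B] using RingQuot.mkAlgHom_rel ℂ (Rel.BBB (κ := κ) i j k ξ η ε)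

theorem commut_commut_F_F_F (i j k : κ) (ξ η ε : ℤˣ) :
    commut (commut (F ι i ξ) (F ι j η)) (F ι k ε)
      = (1 / 2 * (sgn ε - sgn η) ^ 2 * kron j k) • F ι i ξ
        - (1 / 2 * (sgn ε - sgn ξ) ^ 2 * kron i k) • F ι j η := by
  simpa [commut, F] using RingQuot.mkAlgHom_rel ℂ (Rel.FFF (ι := ι) i j k ξ η ε)

theorem commut_anticommut_B_B_F (k l : ι) (m : κ) (ξ η ε : ℤˣ) :
    commut (anticommut (B κ k ξ) (B κ l η)) (F ι m ε) = 0 := by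
  simpa [commut, anticommut, B, F] using RingQuot.mkAlgHom_rel ℂ (Rel.BBF k l m ξ η ε)

theorem commut_commut_F_F_B (k l : κ) (m : ι) (ξ η ε : ℤˣ) :
    commut (commut (F ι k ξ) (F ι l η)) (B κ m ε) = 0 := by
  simpa [commut, B, F] using RingQuot.mkAlgHom_rel ℂ (Rel.FFB k l m ξ η ε)

theorem commut_anticommut_F_B_B (m : κ) (k l : ι) (ξ η ε : ℤˣ) :
    commut (anticommut (F ι m ξ) (B κ k η)) (B κ l ε)
      = ((sgn ε - sgn η) * kron k l) • F ι m ξ := by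
  simpa [commut, anticommut, B, F] using RingQuot.mkAlgHom_rel ℂ (Rel.FBB m k l ξ η ε)

theorem anticommut_anticommut_B_F_F (m : ι) (k l : κ) (ξ η ε : ℤˣ) :
    anticommut (anticommut (B κ m ξ) (F ι k η)) (F ι l ε)
      = (1 / 2 * (sgn ε - sgn η) ^ 2 * kron k l) • B κ m ξ := by
  simpa [anticommut, B, F] using RingQuot.mkAlgHom_rel ℂ (Rel.BFF m k l ξ η ε)

section Lift

variable {R : Type*} [Ring R] [Algebra ℂ R] (b : ι → ℤˣ → R) (f : κ → ℤˣ → R)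

/-- The family of generators with given parabosonic and parafermionic members. -/
def genMap : Gen ι κ → R
  | .B i ε => b i ε
  | .F j ε => f j ε

/-- The universal property of the relative parabose set. -/
noncomputable def liftPBF
    (hBBB : ∀ i j k ξ η ε, commut (anticommut (b i ξ) (b j η)) (b k ε)
      = ((sgn ε - sgn η) * kron j k) • b i ξ + ((sgn ε - sgn ξ) * kron i k) • b j η)
    (hFFF : ∀ i j k ξ η ε, commut (commut (f i ξ) (f j η)) (f k ε)
      = (1 / 2 * (sgn ε - sgn η) ^ 2 * kron j k) • f i ξ
        - (1 / 2 * (sgn ε - sgn ξ) ^ 2 * kron i k) • f j η)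
    (hBBF : ∀ k l m ξ η ε, commut (anticommut (b k ξ) (b l η)) (f m ε) = 0)
    (hFFB : ∀ k l m ξ η ε, commut (commut (f k ξ) (f l η)) (b m ε) = 0)
    (hFBB : ∀ m k l ξ η ε, commut (anticommut (f m ξ) (b k η)) (b l ε)
      = ((sgn ε - sgn η) * kron k l) • f m ξ)
    (hBFF : ∀ m k l ξ η ε, anticommut (anticommut (b m ξ) (f k η)) (f l ε)
      = (1 / 2 * (sgn ε - sgn η) ^ 2 * kron k l) • b m ξ) : PBF ι κ →ₐ[ℂ] R :=
  RingQuot.liftAlgHom ℂ ⟨FreeAlgebra.lift ℂ (genMap b f), by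
    have hb : ∀ i ε, FreeAlgebra.lift ℂ (genMap b f) (freeB ι κ i ε) = b i ε := fun i ε => by
      simp [freeB, genMap]
    have hf : ∀ j ε, FreeAlgebra.lift ℂ (genMap b f) (freeF ι κ j ε) = f j ε := fun j ε => by
      simp [freeF, genMap]
    simp only [commut, anticommut] at *
    rintro _ _ (_ | _ | _ | _ | _ | _) <;>
      simp only [commut, anticommut, map_sub, map_add, map_mul, map_smul, map_zero, *]⟩

theorem liftPBF_B (h₁ h₂ h₃ h₄ h₅ h₆) (i : ι) (ε : ℤˣ) :
    liftPBF b f h₁ h₂ h₃ h₄ h₅ h₆ (B κ i ε) = b i ε := by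
  simp [liftPBF, B, freeB, genMap]

theorem liftPBF_F (h₁ h₂ h₃ h₄ h₅ h₆) (j : κ) (ε : ℤˣ) :
    liftPBF b f h₁ h₂ h₃ h₄ h₅ h₆ (F ι j ε) = f j ε := by
  simp [liftPBF, F, freeF, genMap]

variable {b f} in
theorem PBF_hom_ext {φ ψ : PBF ι κ →ₐ[ℂ] R} (hB : ∀ i ε, φ (B κ i ε) = ψ (B κ i ε))
    (hF : ∀ j ε, φ (F ι j ε) = ψ (F ι j ε)) : φ = ψ := by
  apply RingQuot.ringQuot_ext'
  apply FreeAlgebra.hom_ext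
  ext (⟨i, ε⟩ | ⟨j, ε⟩)
  · exact hB i ε
  · exact hF j ε

end Lift

/-! ### The grading -/

theorem gradedComp_zero_zero : gradedComp ι κ (0, 0) = Submodule.span ℂ (gens00 ι κ) := by
  simp [gradedComp, gensOf]

theorem gradedComp_zero_one : gradedComp ι κ (0, 1) = Submodule.span ℂ (gens01 ι κ) := by
  simp [gradedComp, gensOf]

theorem gradedComp_one_zero : gradedComp ι κ (1, 0) = Submodule.span ℂ (gens10 ι κ) := by
  simp [gradedComp, gensOf]

theorem gradedComp_one_one : gradedComp ι κ (1, 1) = Submodule.span ℂ (gens11 ι κ) := by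
  simp [gradedComp, gensOf]

theorem B_mem (i : ι) (ε : ℤˣ) : B κ i ε ∈ gradedComp ι κ (1, 0) :=
  gradedComp_one_zero (ι := ι) (κ := κ) ▸ Submodule.subset_span ⟨i, ε, rfl⟩

theorem F_mem (j : κ) (ε : ℤˣ) : F ι j ε ∈ gradedComp ι κ (1, 1) :=
  gradedComp_one_one (ι := ι) (κ := κ) ▸ Submodule.subset_span ⟨j, ε, rfl⟩

theorem anticommut_B_B_mem (i j : ι) (ε η : ℤˣ) :
    anticommut (B κ i ε) (B κ j η) ∈ gradedComp ι κ (0, 0) :=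
  gradedComp_zero_zero (ι := ι) (κ := κ) ▸ Submodule.subset_span (.inl ⟨i, j, ε, η, rfl⟩)

theorem commut_F_F_mem (i j : κ) (ε η : ℤˣ) :
    commut (F ι i ε) (F ι j η) ∈ gradedComp ι κ (0, 0) :=
  gradedComp_zero_zero (ι := ι) (κ := κ) ▸ Submodule.subset_span (.inr ⟨i, j, ε, η, rfl⟩)

theorem anticommut_F_B_mem (j : κ) (i : ι) (ε η : ℤˣ) :
    anticommut (F ι j ε) (B κ i η) ∈ gradedComp ι κ (0, 1) :=
  gradedComp_zero_one (ι := ι) (κ := κ) ▸ Submodule.subset_span ⟨j, i, ε, η, rfl⟩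

theorem commut_smul_smul {A : Type*} [Ring A] [Algebra ℂ A] (a b : ℂ) (x y : A) :
    commut (a • x) (b • y) = (a * b) • commut x y := by
  simp only [commut, smul_mul_smul_comm, smul_sub, mul_comm a b]

theorem anticommut_smul_smul {A : Type*} [Ring A] [Algebra ℂ A] (a b : ℂ) (x y : A) :
    anticommut (a • x) (b • y) = (a * b) • anticommut x y := by
  simp only [anticommut, smul_mul_smul_comm, smul_add, mul_comm a b]

theorem sgn_mul_self (s : ℤˣ) : sgn s * sgn s = 1 := by
  obtain rfl | rfl := Int.units_eq_one_or s <;> simp [sgn]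

theorem anticommut_comm {A : Type*} [Ring A] (x y : A) : anticommut x y = anticommut y x :=
  add_comm _ _

variable (ι κ) in
/-- The automorphism that multiplies the parabosonic generators by the sign `s` and the
parafermionic generators by the sign `t`. -/
noncomputable def signHom (s t : ℤˣ) : PBF ι κ →ₐ[ℂ] PBF ι κ := by
  refine liftPBF (fun i ε => sgn s • B κ i ε) (fun j ε => sgn t • F ι j ε) ?_ ?_ ?_ ?_ ?_ ?_ <;>
    intro i j k ξ η ε
  · rw [anticommut_smul_smul, commut_smul_smul, sgn_mul_self, one_mul, commut_anticommut_B_B_B,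
      smul_add, smul_comm (sgn s), smul_comm (sgn s)]
  · rw [commut_smul_smul, commut_smul_smul, sgn_mul_self, one_mul, commut_commut_F_F_F,
      smul_sub, smul_comm (sgn t), smul_comm (sgn t)]
  · rw [anticommut_smul_smul, commut_smul_smul, commut_anticommut_B_B_F, smul_zero]
  · rw [commut_smul_smul, commut_smul_smul, commut_commut_F_F_B, smul_zero]
  · rw [anticommut_smul_smul, commut_smul_smul, mul_assoc, sgn_mul_self, mul_one,
      commut_anticommut_F_B_B, smul_comm]
  · rw [anticommut_smul_smul, anticommut_smul_smul, mul_assoc, sgn_mul_self, mul_one,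
      anticommut_anticommut_B_F_F, smul_comm]

theorem signHom_B (s t : ℤˣ) (i : ι) (ε : ℤˣ) :
    signHom ι κ s t (B κ i ε) = sgn s • B κ i ε := liftPBF_B ..

theorem signHom_F (s t : ℤˣ) (j : κ) (ε : ℤˣ) :
    signHom ι κ s t (F ι j ε) = sgn t • F ι j ε := liftPBF_F ..

/-- The homogeneous components lie in distinct eigenspaces of a linear combination of sign
automorphisms. -/
theorem iSupIndep_gradedComp : iSupIndep (gradedComp ι κ) := by
  let T : Module.End ℂ (PBF ι κ) :=
    (signHom ι κ (-1) 1).toLinearMap + (2 : ℂ) • (signHom ι κ 1 (-1)).toLinearMap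
  -- the eigenvalue of `T` on the component of degree `a`
  let m : ZMod 2 × ZMod 2 → ℤ := fun a =>
    if a = (0, 0) then 3 else if a = (0, 1) then -3 else if a = (1, 0) then 1 else -1
  have hm : Function.Injective m := by decide
  have hμ : Function.Injective fun a => (m a : ℂ) := Int.cast_injective.comp hm
  refine (T.eigenspaces_iSupIndep.comp hμ).mono fun a => Submodule.span_le.2 ?_
  have hT : ∀ x, T x = signHom ι κ (-1) 1 x + (2 : ℂ) • signHom ι κ 1 (-1) x := fun _ => rfl
  intro x hx
  rw [SetLike.mem_coe, Function.comp_apply, Module.End.mem_eigenspace_iff, hT]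
  simp only [gensOf] at hx
  split_ifs at hx with h₁ h₂ h₃
  · obtain ⟨k, l, ε, η, rfl⟩ | ⟨k, l, ε, η, rfl⟩ := hx <;>
    · simp only [anticommut, commut, map_add, map_sub, map_mul, signHom_B, signHom_F, m, h₁, sgn]
      simp
      module
  · obtain ⟨k, l, ε, η, rfl⟩ := hx
    simp only [anticommut, map_add, map_mul, signHom_B, signHom_F, m, h₂, sgn]
    simp
    module
  · obtain ⟨k, ε, rfl⟩ := hx
    simp only [signHom_B, m, h₃, sgn]
    simp
    module
  · obtain ⟨k, ε, rfl⟩ := hx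
    simp only [signHom_F, m, h₁, h₂, h₃, sgn]
    simp
    module

/-! ### Closure under the color bracket -/

theorem colorBracket_mem_of_span {G : Type*} [AddCommGroup G] (θ : CommutationFactor G)
    {P : Type*} [Ring P] [Algebra ℂ P] {S T : Set P} {N : Submodule ℂ P} {a b : G}
    (h : ∀ x ∈ S, ∀ y ∈ T, colorBracket θ a b x y ∈ N) {x y : P} (hx : x ∈ Submodule.span ℂ S)
    (hy : y ∈ Submodule.span ℂ T) : colorBracket θ a b x y ∈ N := by
  let br : P →ₗ[ℂ] P →ₗ[ℂ] P := LinearMap.mul ℂ P - (θ.val a b : ℂ) • (LinearMap.mul ℂ P).flip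
  have hS : ∀ x ∈ S, ∀ y ∈ Submodule.span ℂ T, br x y ∈ N := fun x hx y hy =>
    (Submodule.span_le.2 (h x hx) : Submodule.span ℂ T ≤ N.comap (br x)) hy
  exact (Submodule.span_le.2 (fun x hx => hS x hx y hy) :
    Submodule.span ℂ S ≤ N.comap (br.flip y)) hx

theorem coe_paraFactor (a b : ZMod 2 × ZMod 2) :
    (paraFactor.val a b : ℂ) = if a.1 * b.1 + a.2 * b.2 = 0 then 1 else -1 := by
  have h : ∀ c : ZMod 2, (((-1 : ℂˣ) ^ c.val : ℂˣ) : ℂ) = if c = 0 then 1 else -1 := by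
    intro c
    obtain rfl | rfl : c = 0 ∨ c = 1 := by decide +revert
    · simp
    · simp [ZMod.val_one]
  exact h _

theorem colorBracket_eq_commut {a b : ZMod 2 × ZMod 2} (h : a.1 * b.1 + a.2 * b.2 = 0)
    {P : Type*} [Ring P] [Algebra ℂ P] (x y : P) :
    colorBracket paraFactor a b x y = commut x y := by
  rw [colorBracket, coe_paraFactor, if_pos h, one_smul, commut]

theorem colorBracket_eq_anticommut {a b : ZMod 2 × ZMod 2} (h : a.1 * b.1 + a.2 * b.2 ≠ 0)
    {P : Type*} [Ring P] [Algebra ℂ P] (x y : P) :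
    colorBracket paraFactor a b x y = anticommut x y := by
  rw [colorBracket, coe_paraFactor, if_neg h, neg_one_smul, sub_neg_eq_add, anticommut]

variable (ι κ) in
/-- The components of degrees `a` and `b` have their color brackets in the component of degree
`a + b`. -/
def BracketClosed (a b : ZMod 2 × ZMod 2) : Prop :=
  ∀ x ∈ gradedComp ι κ a, ∀ y ∈ gradedComp ι κ b,
    colorBracket paraFactor a b x y ∈ gradedComp ι κ (a + b)

theorem BracketClosed.symm {a b : ZMod 2 × ZMod 2} (h : BracketClosed ι κ a b) :
    BracketClosed ι κ b a := by
  intro x hx y hy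
  rw [colorBracket_antisymm, add_comm]
  exact Submodule.neg_mem _ (Submodule.smul_mem _ _ (h y hy x hx))

theorem bracketClosed_of_gens {a b : ZMod 2 × ZMod 2}
    (h : ∀ x ∈ gensOf ι κ a, ∀ y ∈ gensOf ι κ b,
      colorBracket paraFactor a b x y ∈ gradedComp ι κ (a + b)) : BracketClosed ι κ a b :=
  fun _ hx _ hy => colorBracket_mem_of_span paraFactor h hx hy

/-- Brackets of two generators are homogeneous by the definition of the even components. -/
theorem bracketClosed_odd_odd (a b : ZMod 2) : BracketClosed ι κ (1, a) (1, b) := by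
  have h₀₁ : BracketClosed ι κ (1, 1) (1, 0) := by
    refine bracketClosed_of_gens ?_
    rintro _ ⟨j, ε, rfl⟩ _ ⟨i, η, rfl⟩
    rw [colorBracket_eq_anticommut (by decide)]
    exact anticommut_F_B_mem j i ε η
  fin_cases a <;> fin_cases b
  · refine bracketClosed_of_gens ?_
    rintro _ ⟨i, ε, rfl⟩ _ ⟨j, η, rfl⟩
    rw [colorBracket_eq_anticommut (by decide)]
    exact anticommut_B_B_mem i j ε η
  · exact h₀₁.symm
  · exact h₀₁
  · refine bracketClosed_of_gens ?_
    rintro _ ⟨i, ε, rfl⟩ _ ⟨j, η, rfl⟩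
    rw [colorBracket_eq_commut (by decide)]
    exact commut_F_F_mem i j ε η

/-- The trilinear relations express brackets of quadratic elements with generators through
generators. -/
theorem bracketClosed_even_odd (a b : ZMod 2) : BracketClosed ι κ (0, a) (1, b) := by
  fin_cases a <;> fin_cases b <;> refine bracketClosed_of_gens ?_
  · rintro _ (⟨i, j, ε, η, rfl⟩ | ⟨i, j, ε, η, rfl⟩) _ ⟨k, ζ, rfl⟩ <;>
      rw [colorBracket_eq_commut (by decide)]
    · rw [commut_anticommut_B_B_B]
      exact Submodule.add_mem _ (Submodule.smul_mem _ _ (B_mem i ε))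
        (Submodule.smul_mem _ _ (B_mem j η))
    · rw [commut_commut_F_F_B]
      exact Submodule.zero_mem _
  · rintro _ (⟨i, j, ε, η, rfl⟩ | ⟨i, j, ε, η, rfl⟩) _ ⟨k, ζ, rfl⟩ <;>
      rw [colorBracket_eq_commut (by decide)]
    · rw [commut_anticommut_B_B_F]
      exact Submodule.zero_mem _
    · rw [commut_commut_F_F_F]
      exact Submodule.sub_mem _ (Submodule.smul_mem _ _ (F_mem i ε))
        (Submodule.smul_mem _ _ (F_mem j η))
  · rintro _ ⟨j, i, ε, η, rfl⟩ _ ⟨k, ζ, rfl⟩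
    rw [colorBracket_eq_commut (by decide), commut_anticommut_F_B_B]
    exact Submodule.smul_mem _ _ (F_mem j ε)
  · rintro _ ⟨j, i, ε, η, rfl⟩ _ ⟨k, ζ, rfl⟩
    rw [colorBracket_eq_anticommut (by decide), anticommut_comm (F ι j ε),
      anticommut_anticommut_B_F_F]
    exact Submodule.smul_mem _ _ (B_mem i η)

/-- The bracket with an even element is a color derivation, so that it preserves the span of
brackets of generators. -/
theorem bracketClosed_even_even (a b : ZMod 2) : BracketClosed ι κ (0, a) (0, b) := by
  have key : ∀ (c d : ZMod 2) (x y z : PBF ι κ), x ∈ gradedComp ι κ (0, a) →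
      y ∈ gradedComp ι κ (1, c) → z ∈ gradedComp ι κ (1, d) →
      colorBracket paraFactor (0, a) ((1, c) + (1, d)) x (colorBracket paraFactor (1, c) (1, d) y z)
        ∈ gradedComp ι κ ((0, a) + ((1, c) + (1, d))) := by
    intro c d x y z hx hy hz
    have h₁ := bracketClosed_odd_odd _ d _ (bracketClosed_even_odd a c x hx y hy) z hz
    have h₂ := bracketClosed_odd_odd c _ y hy _ (bracketClosed_even_odd a d x hx z hz)
    rw [colorBracket_leibniz]
    refine Submodule.add_mem _ ?_ (Submodule.smul_mem _ _ ?_)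
    · rw [← add_assoc]
      exact h₁
    · rw [add_left_comm]
      exact h₂
  intro x hx y hy
  suffices gradedComp ι κ (0, b) ≤ (gradedComp ι κ ((0, a) + (0, b))).comap
      (LinearMap.mul ℂ (PBF ι κ) x - (paraFactor.val (0, a) (0, b) : ℂ) •
        (LinearMap.mul ℂ (PBF ι κ)).flip x) from this hy
  refine Submodule.span_le.2 ?_
  fin_cases b
  · rintro _ (⟨i, j, ε, η, rfl⟩ | ⟨i, j, ε, η, rfl⟩)
    · have h := key 0 0 x _ _ hx (B_mem i ε) (B_mem j η)
      rwa [colorBracket_eq_anticommut (a := (1, 0)) (b := (1, 0)) (by decide)] at h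
    · have h := key 1 1 x _ _ hx (F_mem i ε) (F_mem j η)
      rwa [colorBracket_eq_commut (a := (1, 1)) (b := (1, 1)) (by decide)] at h
  · rintro _ ⟨i, j, ε, η, rfl⟩
    have h := key 1 0 x _ _ hx (F_mem i ε) (B_mem j η)
    rwa [colorBracket_eq_anticommut (a := (1, 1)) (b := (1, 0)) (by decide)] at h

theorem colorBracket_mem (a b : ZMod 2 × ZMod 2) (x y : PBF ι κ) (hx : x ∈ gradedComp ι κ a)
    (hy : y ∈ gradedComp ι κ b) : colorBracket paraFactor a b x y ∈ gradedComp ι κ (a + b) := by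
  obtain ⟨a, a'⟩ := a
  obtain ⟨b, b'⟩ := b
  suffices BracketClosed ι κ (a, a') (b, b') from this x hx y hy
  fin_cases a <;> fin_cases b
  · exact bracketClosed_even_even a' b'
  · exact bracketClosed_even_odd a' b'
  · exact (bracketClosed_even_odd b' a').symm
  · exact bracketClosed_odd_odd a' b'

/-! ### The color Lie algebra and its universal enveloping algebra -/

variable (ι κ) in
/-- The color Lie algebra spanned by the generators and their color brackets. -/
noncomputable def colorAlg : ColorLieAlgebra paraFactor (colorSpace ι κ) :=
  .ofSubspaces paraFactor (gradedComp ι κ) _ rfl iSupIndep_gradedComp colorBracket_mem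

theorem colorBracket_superFactor (a b : ZMod 2) (x y : PBF ι κ) :
    colorBracket superFactor a b x y = colorBracket paraFactor (0, a) (0, b) x y := by
  simp [colorBracket, superFactor, paraFactor]

theorem iSup_gradedComp_even : ⨆ a : ZMod 2, gradedComp ι κ (0, a) = superSpace ι κ := by
  rw [superSpace, Submodule.span_union, ← gradedComp_zero_zero, ← gradedComp_zero_one]
  refine le_antisymm (iSup_le fun a => ?_) (sup_le (le_iSup (fun a : ZMod 2 =>
    gradedComp ι κ (0, a)) 0) (le_iSup (fun a : ZMod 2 => gradedComp ι κ (0, a)) 1))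
  fin_cases a
  · exact le_sup_left
  · exact le_sup_right

variable (ι κ) in
/-- The Lie superalgebra spanned by the color brackets of the generators. -/
noncomputable def superAlg : LieSuperalgebra (superSpace ι κ) :=
  .ofSubspaces superFactor (fun a => gradedComp ι κ (0, a)) _ iSup_gradedComp_even
    (iSupIndep_gradedComp.comp (Prod.mk_right_injective 0)) fun a b x y hx hy => by
      rw [colorBracket_superFactor]
      simpa using colorBracket_mem (0, a) (0, b) x y hx hy

theorem coe_colorAlg_bracket {a b : ZMod 2 × ZMod 2} {x y : colorSpace ι κ}
    (hx : (x : PBF ι κ) ∈ gradedComp ι κ a) (hy : (y : PBF ι κ) ∈ gradedComp ι κ b) :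
    ((colorAlg ι κ).bracket x y : PBF ι κ) = colorBracket paraFactor a b (x : PBF ι κ) y :=
  ColorLieAlgebra.coe_ofSubspaces_bracket paraFactor _ _ _ _ _ hx hy

theorem coe_superAlg_bracket {a b : ZMod 2} {x y : superSpace ι κ}
    (hx : (x : PBF ι κ) ∈ gradedComp ι κ (0, a)) (hy : (y : PBF ι κ) ∈ gradedComp ι κ (0, b)) :
    ((superAlg ι κ).bracket x y : PBF ι κ) = colorBracket superFactor a b (x : PBF ι κ) y :=
  ColorLieAlgebra.coe_ofSubspaces_bracket superFactor (fun a => gradedComp ι κ (0, a)) _ _ _ _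
    hx hy

theorem incl_bracket (x y : superSpace ι κ) :
    incl ι κ ((superAlg ι κ).bracket x y)
      = (colorAlg ι κ).bracket (incl ι κ x) (incl ι κ y) := by
  suffices (superAlg ι κ).bracket.compr₂ (incl ι κ)
      = (colorAlg ι κ).bracket.compl₁₂ (incl ι κ) (incl ι κ) from LinearMap.congr_fun₂ this x y
  have h : ∀ a x, x ∈ (superAlg ι κ).piece a → ∀ y, incl ι κ ((superAlg ι κ).bracket x y)
      = (colorAlg ι κ).bracket (incl ι κ x) (incl ι κ y) := by
    intro a x hx y
    refine (superAlg ι κ).le_of_piece_le (N := LinearMap.eqLocus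
      (incl ι κ ∘ₗ (superAlg ι κ).bracket x)
      ((colorAlg ι κ).bracket (incl ι κ x) ∘ₗ incl ι κ)) (fun b y hy => ?_) y
    apply Subtype.ext
    exact (coe_superAlg_bracket hx hy).trans ((colorBracket_superFactor a b _ _).trans
      (coe_colorAlg_bracket (x := incl ι κ x) (y := incl ι κ y) hx hy).symm)
  apply LinearMap.ext
  intro x
  exact (superAlg ι κ).le_of_piece_le (N := LinearMap.eqLocus _ _)
    (fun a x hx => LinearMap.ext (h a x hx)) x

/-- The generator `B_i^ε` as an element of the color Lie algebra. -/
noncomputable def elemB (i : ι) (ε : ℤˣ) : colorSpace ι κ :=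
  ⟨B κ i ε, le_iSup (gradedComp ι κ) _ (B_mem i ε)⟩

/-- The generator `F_j^ε` as an element of the color Lie algebra. -/
noncomputable def elemF (j : κ) (ε : ℤˣ) : colorSpace ι κ :=
  ⟨F ι j ε, le_iSup (gradedComp ι κ) _ (F_mem j ε)⟩

theorem commut_toEnv {a b : ZMod 2 × ZMod 2} (h : a.1 * b.1 + a.2 * b.2 = 0)
    {x y z : colorSpace ι κ} (hx : (x : PBF ι κ) ∈ gradedComp ι κ a)
    (hy : (y : PBF ι κ) ∈ gradedComp ι κ b) (hz : commut (x : PBF ι κ) y = z) :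
    commut ((colorAlg ι κ).toEnv x) ((colorAlg ι κ).toEnv y) = (colorAlg ι κ).toEnv z := by
  have h' : z = (colorAlg ι κ).bracket x y := Subtype.ext (by
    rw [coe_colorAlg_bracket hx hy, colorBracket_eq_commut h, hz])
  rw [h', ← (colorAlg ι κ).toEnv_bracket hx hy]
  exact (colorBracket_eq_commut h _ _).symm

theorem anticommut_toEnv {a b : ZMod 2 × ZMod 2} (h : a.1 * b.1 + a.2 * b.2 ≠ 0)
    {x y z : colorSpace ι κ} (hx : (x : PBF ι κ) ∈ gradedComp ι κ a)
    (hy : (y : PBF ι κ) ∈ gradedComp ι κ b) (hz : anticommut (x : PBF ι κ) y = z) :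
    anticommut ((colorAlg ι κ).toEnv x) ((colorAlg ι κ).toEnv y) = (colorAlg ι κ).toEnv z := by
  have h' : z = (colorAlg ι κ).bracket x y := Subtype.ext (by
    rw [coe_colorAlg_bracket hx hy, colorBracket_eq_anticommut h, hz])
  rw [h', ← (colorAlg ι κ).toEnv_bracket hx hy]
  exact (colorBracket_eq_anticommut h _ _).symm

theorem anticommut_toEnv_B_B (i j : ι) (ε η : ℤˣ) :
    anticommut ((colorAlg ι κ).toEnv (elemB i ε)) ((colorAlg ι κ).toEnv (elemB j η))
      = (colorAlg ι κ).toEnv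
        ⟨anticommut (B κ i ε) (B κ j η), le_iSup (gradedComp ι κ) _ (anticommut_B_B_mem i j ε η)⟩ :=
  anticommut_toEnv (by decide) (B_mem i ε) (B_mem j η) rfl

theorem commut_toEnv_F_F (i j : κ) (ε η : ℤˣ) :
    commut ((colorAlg ι κ).toEnv (elemF i ε)) ((colorAlg ι κ).toEnv (elemF j η))
      = (colorAlg ι κ).toEnv
        ⟨commut (F ι i ε) (F ι j η), le_iSup (gradedComp ι κ) _ (commut_F_F_mem i j ε η)⟩ :=
  commut_toEnv (by decide) (F_mem i ε) (F_mem j η) rfl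

theorem anticommut_toEnv_F_B (j : κ) (i : ι) (ε η : ℤˣ) :
    anticommut ((colorAlg ι κ).toEnv (elemF j ε)) ((colorAlg ι κ).toEnv (elemB i η))
      = (colorAlg ι κ).toEnv
        ⟨anticommut (F ι j ε) (B κ i η), le_iSup (gradedComp ι κ) _ (anticommut_F_B_mem j i ε η)⟩ :=
  anticommut_toEnv (by decide) (F_mem j ε) (B_mem i η) rfl

variable (ι κ) in
/-- The homomorphism from the relative parabose set to the universal enveloping algebra that is
the identity on generators. -/
noncomputable def toEnvHom : PBF ι κ →ₐ[ℂ] (colorAlg ι κ).Env := by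
  refine liftPBF (fun i ε => (colorAlg ι κ).toEnv (elemB i ε))
    (fun j ε => (colorAlg ι κ).toEnv (elemF j ε)) ?_ ?_ ?_ ?_ ?_ ?_ <;> intro i j k ξ η ε
  · rw [anticommut_toEnv_B_B, ← map_smul, ← map_smul, ← map_add]
    exact commut_toEnv (by decide) (anticommut_B_B_mem i j ξ η) (B_mem k ε)
      (commut_anticommut_B_B_B i j k ξ η ε)
  · rw [commut_toEnv_F_F, ← map_smul, ← map_smul, ← map_sub]
    exact commut_toEnv (by decide) (commut_F_F_mem i j ξ η) (F_mem k ε)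
      (commut_commut_F_F_F i j k ξ η ε)
  · rw [anticommut_toEnv_B_B, ← map_zero (colorAlg ι κ).toEnv]
    exact commut_toEnv (by decide) (anticommut_B_B_mem i j ξ η) (F_mem k ε)
      (commut_anticommut_B_B_F i j k ξ η ε)
  · rw [commut_toEnv_F_F, ← map_zero (colorAlg ι κ).toEnv]
    exact commut_toEnv (by decide) (commut_F_F_mem i j ξ η) (B_mem k ε)
      (commut_commut_F_F_B i j k ξ η ε)
  · rw [anticommut_toEnv_F_B, ← map_smul]
    exact commut_toEnv (by decide) (anticommut_F_B_mem i j ξ η) (B_mem k ε)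
      (commut_anticommut_F_B_B i j k ξ η ε)
  · rw [anticommut_comm (ColorLieAlgebra.toEnv _ (elemB i ξ)), anticommut_toEnv_F_B, ← map_smul]
    exact anticommut_toEnv (by decide) (anticommut_F_B_mem j i η ξ) (F_mem k ε)
      ((congrArg (anticommut · (F ι k ε)) (anticommut_comm _ _)).trans
        (anticommut_anticommut_B_F_F i j k ξ η ε))

theorem toEnvHom_B (i : ι) (ε : ℤˣ) :
    toEnvHom ι κ (B κ i ε) = (colorAlg ι κ).toEnv (elemB i ε) := liftPBF_B ..

theorem toEnvHom_F (j : κ) (ε : ℤˣ) :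
    toEnvHom ι κ (F ι j ε) = (colorAlg ι κ).toEnv (elemF j ε) := liftPBF_F ..

theorem toEnvHom_coe (x : colorSpace ι κ) :
    toEnvHom ι κ (x : PBF ι κ) = (colorAlg ι κ).toEnv x := by
  refine (colorAlg ι κ).le_of_piece_le (N := LinearMap.eqLocus
    ((toEnvHom ι κ).toLinearMap ∘ₗ (colorSpace ι κ).subtype) (colorAlg ι κ).toEnv) ?_ x
  intro a x hx
  have hspan : gradedComp ι κ a ≤ (LinearMap.eqLocus
      ((toEnvHom ι κ).toLinearMap ∘ₗ (colorSpace ι κ).subtype) (colorAlg ι κ).toEnv).map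
      (colorSpace ι κ).subtype := by
    refine Submodule.span_le.2 ?_
    intro p hp
    simp only [gensOf] at hp
    split_ifs at hp with h₁ h₂ h₃
    · obtain ⟨k, l, ε, η, rfl⟩ | ⟨k, l, ε, η, rfl⟩ := hp
      · refine ⟨⟨_, le_iSup (gradedComp ι κ) _ (anticommut_B_B_mem k l ε η)⟩, ?_, rfl⟩
        refine Eq.trans ?_ (anticommut_toEnv_B_B k l ε η)
        simp [anticommut, toEnvHom_B]
      · refine ⟨⟨_, le_iSup (gradedComp ι κ) _ (commut_F_F_mem k l ε η)⟩, ?_, rfl⟩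
        refine Eq.trans ?_ (commut_toEnv_F_F k l ε η)
        simp [commut, toEnvHom_F]
    · obtain ⟨k, l, ε, η, rfl⟩ := hp
      refine ⟨⟨_, le_iSup (gradedComp ι κ) _ (anticommut_F_B_mem k l ε η)⟩, ?_, rfl⟩
      refine Eq.trans ?_ (anticommut_toEnv_F_B k l ε η)
      simp [anticommut, toEnvHom_F, toEnvHom_B]
    · obtain ⟨k, ε, rfl⟩ := hp
      exact ⟨elemB k ε, toEnvHom_B k ε, rfl⟩
    · obtain ⟨k, ε, rfl⟩ := hp
      exact ⟨elemF k ε, toEnvHom_F k ε, rfl⟩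
  obtain ⟨y, hy, hyx⟩ := hspan hx
  rwa [← Subtype.ext hyx]

variable (ι κ) in
/-- The homomorphism from the universal enveloping algebra to the relative parabose set that extends
the inclusion of the color Lie algebra. -/
noncomputable def colorHom : (colorAlg ι κ).Env →ₐ[ℂ] PBF ι κ :=
  ColorLieAlgebra.ofSubspacesHom paraFactor (gradedComp ι κ) _ rfl iSupIndep_gradedComp
    colorBracket_mem

theorem colorHom_toEnv (x : colorSpace ι κ) : colorHom ι κ ((colorAlg ι κ).toEnv x) = x :=
  ColorLieAlgebra.ofSubspacesHom_toEnv ..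

variable (ι κ) in
/-- The universal enveloping algebra of the color Lie algebra is the relative parabose set. -/
noncomputable def envEquivPBF : (colorAlg ι κ).Env ≃ₐ[ℂ] PBF ι κ :=
  AlgEquiv.ofAlgHom (colorHom ι κ) (toEnvHom ι κ)
    (PBF_hom_ext
      (fun i ε => (congrArg (colorHom ι κ) (toEnvHom_B i ε)).trans (colorHom_toEnv _))
      (fun j ε => (congrArg (colorHom ι κ) (toEnvHom_F j ε)).trans (colorHom_toEnv _)))
    ((colorAlg ι κ).hom_ext fun _ x _ =>
      (congrArg (toEnvHom ι κ) (colorHom_toEnv x)).trans (toEnvHom_coe x))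

theorem envEquivPBF_toEnv (x : colorSpace ι κ) :
    envEquivPBF ι κ ((colorAlg ι κ).toEnv x) = x :=
  colorHom_toEnv x

variable (ι κ) in
/-- The homomorphism from the universal enveloping algebra of the Lie superalgebra to the relative
parabose set. -/
noncomputable def superHom : (superAlg ι κ).Env →ₐ[ℂ] PBF ι κ :=
  ColorLieAlgebra.ofSubspacesHom superFactor (fun a => gradedComp ι κ (0, a)) _ _ _ _

theorem superHom_toEnv (x : superSpace ι κ) : superHom ι κ ((superAlg ι κ).toEnv x) = x :=
  ColorLieAlgebra.ofSubspacesHom_toEnv ..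

/-- After identifying the relative parabose set with the universal enveloping algebra of the color
Lie algebra, `superHom` is the homomorphism induced by the inclusion of the Lie superalgebra over
the map of grading groups `a ↦ (0, a)`. -/
theorem superHom_injective : Function.Injective (superHom ι κ) := by
  have h : ∀ x : superSpace ι κ, (envEquivPBF ι κ).symm x
      = (colorAlg ι κ).toEnv (incl ι κ x) := fun x => by
    rw [AlgEquiv.symm_apply_eq, envEquivPBF_toEnv]
    rfl
  have hinj : Function.Injective ((envEquivPBF ι κ).symm.toAlgHom.comp (superHom ι κ)) := by
    refine (superAlg ι κ).injective_of_injective_toEnv (colorAlg ι κ) (fun a => (0, a))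
      (fun a b => by simp [superFactor, paraFactor]) (incl ι κ) (fun a x hx => hx) _
      (fun x => ?_) ?_
    · rw [AlgHom.comp_apply, superHom_toEnv]
      exact h x
    · intro x y hxy
      simp only [← h] at hxy
      exact Subtype.ext ((envEquivPBF ι κ).symm.injective hxy)
  exact Function.Injective.of_comp hinj

theorem range_superHom :
    (superHom ι κ).range = Algebra.adjoin ℂ (superSpace ι κ : Set (PBF ι κ)) :=
  ColorLieAlgebra.range_ofSubspacesHom ..

end RelParabose

theorem mainTheorem3 (ι κ : Type*) [DecidableEq ι] [DecidableEq κ] :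
    ∃ (L : ColorLieAlgebra paraFactor (colorSpace ι κ)) (S : LieSuperalgebra (superSpace ι κ)),
      -- `L` carries the color bracket, and `P_BF` is its universal enveloping algebra
      (∀ (a : ZMod 2 × ZMod 2) (x : colorSpace ι κ),
        x ∈ L.piece a ↔ (x : PBF ι κ) ∈ gradedComp ι κ a) ∧
      (∀ (a b : ZMod 2 × ZMod 2) (x y : colorSpace ι κ), x ∈ L.piece a → y ∈ L.piece b →
        ((L.bracket x y : colorSpace ι κ) : PBF ι κ) =
          (x : PBF ι κ) * (y : PBF ι κ)
            - (paraFactor.val a b : ℂ) • ((y : PBF ι κ) * (x : PBF ι κ))) ∧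
      (∃ e : L.UEA ≃ₐ[ℂ] PBF ι κ, ∀ x : colorSpace ι κ, e (L.toUEA x) = (x : PBF ι κ)) ∧
      -- `S = L₀₀ ⊕ L₀₁` with the restricted color bracket
      (∀ (a : ZMod 2) (x : superSpace ι κ),
        x ∈ S.piece a ↔ (x : PBF ι κ) ∈ gradedComp ι κ (0, a)) ∧
      (∀ x y : superSpace ι κ, incl ι κ (S.bracket x y) = L.bracket (incl ι κ x) (incl ι κ y)) ∧
      -- the universal enveloping algebra of `S` is the subalgebra of `P_BF` generated by `S`
      (∃ f : S.UEA →ₐ[ℂ] PBF ι κ, (∀ x : superSpace ι κ, f (S.toUEA x) = (x : PBF ι κ)) ∧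
        Function.Injective f ∧
        f.range = Algebra.adjoin ℂ (superSpace ι κ : Set (PBF ι κ))) := by
  refine ⟨colorAlg ι κ, superAlg ι κ, fun a x => Iff.rfl, fun a b x y hx hy =>
    coe_colorAlg_bracket hx hy, ⟨(colorAlg ι κ).envEquiv.trans (envEquivPBF ι κ),
    envEquivPBF_toEnv⟩, fun a x => Iff.rfl, incl_bracket,
    (superHom ι κ).comp (superAlg ι κ).envEquiv.toAlgHom, superHom_toEnv,
    superHom_injective.comp (superAlg ι κ).envEquiv.injective, ?_⟩
  rw [← range_superHom]
  exact SetLike.coe_injective ((superAlg ι κ).envEquiv.surjective.range_comp (superHom ι κ))
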